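/- Consider $N$ sources that share one server without a buffer (the multi-source M/G/1/1 bufferless preemptive system). Source $j$ generates updates according to a Poisson process of rate $\lambda_j>0$; put $\lambda=\sum_{j=1}^N\lambda_j$. The Poisson processes are independent, and each update requires a service time, the service times being i.i.d. with probability density $f_S$ (vanishing on $(-\infty,0)$) and independent of the arrivals. The system is empty at time $0$. An update enters service when it arrives and is discarded as soon as another update (of any source) arrives before its service is completed; otherwise it is received by the monitor when its service is completed. Let $L_S(s)=\int_0^\infty e^{-st}f_S(t)\,dt$. Fix a source $i$. Almost surely infinitely many of its updates are received; for $k\ge 1$ let $t_{i,k}$ and $t'_{i,k}$ be the arrival and departure moments of the $k$-th received update of source $i$, and let $T_{i,k}=t'_{i,k}-t_{i,k}$ and $Y_{i,k+1}=t'_{i,k+1}-t'_{i,k}$. The inter-departure times $Y_{i,k+1}$, $k\ge1$, have a common probability density $f_{Y_i}$. The peak age of information of the $k$-th received update, that is, the time $t'_{i,k+1}-t_{i,k}$ from its arrival until it is replaced at the monitor by the next received update of source $i$, is $$\Delta^{\mathrm P}_{i,k}=Y_{i,k+1}+T_{i,k}.$$ For every $k\ge1$ and every $p_i>0$, its violation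 probability $P_i^{\mathrm P}(p_i)=\Pr\{\Delta^{\mathrm P}_{i,k}>p_i\}$ is $$P_i^{\mathrm P}(p_i)=1-\frac1{L_S(\lambda)}\int_0^{p_i}f_{Y_i}(y)\int_0^{p_i-y}e^{-\lambda t}f_S(t)\,dt\,dy,$$ and $\Delta^{\mathrm P}_{i,k}$ has the probability density $$f_{\Delta_i^{\mathrm P}}(x)=\begin{cases}\dfrac1{L_S(\lambda)}\displaystyle\int_0^x e^{-\lambda(x-y)}f_{Y_i}(y)f_S(x-y)\,dy,&x\ge0,\\[2mm]0,&x<0,\end{cases}$$ where the last integral converges for almost every $x\ge0$. Both formulas hold for every version of the density $f_{Y_i}$. -/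

import Mathlib

open MeasureTheory ProbabilityTheory

namespace MultiSourceQueue

noncomputable section

/-- `f` is a probability density function (with respect to Lebesgue measure) of the real random
variable `X` under `P`. -/
structure IsPDF {Ω : Type*} [MeasurableSpace Ω] (P : Measure Ω) (X : Ω → ℝ) (f : ℝ → ℝ) : Prop where
  measurable : Measurable f
  nonneg : ∀ x, 0 ≤ f x
  aemeasurable : AEMeasurable X P
  map_eq : P.map X = volume.withDensity (fun x => ENNReal.ofReal (f x))

/-- The unilateral Laplace transform of a function. -/
def laplace (f : ℝ → ℝ) (s : ℝ) : ℝ := ∫ t in Set.Ioi (0 : ℝ), Real.exp (-s * t) * f t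

/-- The random input of an M/G/1/1 system with sources `j : Fin N`, which starts empty at time `0`.
`X j n` is the time between the `(n-1)`-st and the `n`-th update of source `j` (between time `0`
and the first update if `n = 0`), and `S j n` is the service time that the `n`-th update of source
`j` requires. Source `j` generates its updates by a Poisson process of rate `rate j`, that is, with
i.i.d. exponential inter-arrival times; the service times are i.i.d. with p.d.f. `fS`, which
vanishes on the negative half-line; and all of these variables are mutually independent. -/
structure IsInput {Ω : Type*} [MeasurableSpace Ω] (P : Measure Ω) {N : ℕ} (rate : Fin N → ℝ)
    (fS : ℝ → ℝ) (X S : Fin N → ℕ → Ω → ℝ) : Prop where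
  rate_pos : ∀ j, 0 < rate j
  measurable_interarrival : ∀ j n, Measurable (X j n)
  measurable_service : ∀ j n, Measurable (S j n)
  interarrival_law : ∀ j n, P.map (X j n) = expMeasure (rate j)
  service_pdf : ∀ j n, IsPDF P (S j n) fS
  service_nonneg : ∀ x < 0, fS x = 0
  indep : iIndepFun (fun z : (Fin N × ℕ) ⊕ (Fin N × ℕ) =>
    Sum.elim (fun a => X a.1 a.2) (fun a => S a.1 a.2) z) P

variable {Ω : Type*} {N : ℕ} (X S : Fin N → ℕ → Ω → ℝ)

/-- The arrival moment of the `n`-th update of source `j`. -/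
def arrival (j : Fin N) (n : ℕ) (ω : Ω) : ℝ := ∑ m ∈ Finset.range (n + 1), X j m ω

/-- The bufferless preemptive discipline. An update enters service when it arrives, and it is
discarded as soon as another update, of any source, arrives before its service is completed. So
the `n`-th update of source `j` is successfully received by the monitor if and only if no update
arrives during its service. -/
def Received (j : Fin N) (n : ℕ) (ω : Ω) : Prop :=
  ¬ ∃ (l : Fin N) (m : ℕ), arrival X j n ω < arrival X l m ω ∧
    arrival X l m ω < arrival X j n ω + S j n ω

/-- The number, among all updates of source `j`, of its `k`-th successfully received update;
`k = 0` is the first one. -/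
def receivedIndex (j : Fin N) (k : ℕ) (ω : Ω) : ℕ := Nat.nth (fun n => Received X S j n ω) k

/-- The arrival moment of the `k`-th successfully received update of source `j`. -/
def receivedArrival (j : Fin N) (k : ℕ) (ω : Ω) : ℝ := arrival X j (receivedIndex X S j k ω) ω

/-- The departure moment of the `k`-th successfully received update of source `j`: it is served
without interruption from its arrival on. -/
def departure (j : Fin N) (k : ℕ) (ω : Ω) : ℝ :=
  receivedArrival X S j k ω + S j (receivedIndex X S j k ω) ω

/-- The system time of the `k`-th successfully received update of source `j`. -/
def systemTime (j : Fin N) (k : ℕ) (ω : Ω) : ℝ := departure X S j k ω - receivedArrival X S j k ω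

/-- The inter-departure time between the `(k+1)`-st successfully received update of source `j`
and the `k`-th one. -/
def interDeparture (j : Fin N) (k : ℕ) (ω : Ω) : ℝ :=
  departure X S j (k + 1) ω - departure X S j k ω

/-- The peak age of information of the `k`-th successfully received update of source `j`: the time
between its arrival and the moment when the next successfully received update of source `j`
replaces it at the monitor. -/
def peakAge (j : Fin N) (k : ℕ) (ω : Ω) : ℝ := departure X S j (k + 1) ω - receivedArrival X S j k ω

/-- The violation probability: the probability that the peak age exceeds the threshold `p`. -/
def violationProb [MeasurableSpace Ω] (P : Measure Ω) (j : Fin N) (k : ℕ) (p : ℝ) : ℝ :=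
  P.real {ω | p < peakAge X S j k ω}

end

end MultiSourceQueue

open scoped ENNReal

namespace MultiSourceQueue

/-! ### The exponential distribution -/

/-! Everything rests on a renewal identity at the first update of all sources. Since independent
exponential clocks compete without memory, that update arrives after an `Exp(λ)` time `g`, comes
from source `j` with probability `λ_j/λ`, requires a service time `s`, and is followed by a copy `e`
of the whole input, with `g`, the source, `s` and `e` independent (`IsUpdatesLaw.map_prepend`). It
is received exactly when `e` has no arrival before `s`.

Let `D` be an event that only a received first update of source `i` can affect, and let `Q` describe
`D` in terms of `(s, e)` in that case. The prepended input and `e` have the same law, and they agree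
about `D` unless the first update is a received update of source `i`. Hence the two probabilities of
`D` on this exceptional event coincide as well. Moreover `D` does not depend on the first arrival
time of `e`, which alone decides whether there is an arrival before `s`. Cancelling the probability
of source `i` yields `c · P(D) = P(no arrival in e before s, Q)`, where `c = L_S(λ)` is the
probability of an uninterrupted service (`IsRenewal.measure_eq`). No stopping times or series are
needed.

Three applications follow. If `D` says that at most `k` updates are received, then `Q` is empty for
`k = 0` and is the event for `k - 1` otherwise, so infinitely many updates are received almost
surely. If `D` concerns the pair (system time, inter-departure time) with index `k + 1`, then `Q` is
the same event with index `k`, so the joint law does not depend on `k`. For index `0`,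
memorylessness factors the law: the system time has density `e^{-λt} f_S(t) / L_S(λ)`, and the
inter-departure time is independent of it and distributed as the first departure time
(`map_systemTime_interDeparture`). The peak age is the sum of the two, so its law is a convolution.
-/

lemma expMeasure_eq_withDensity (r : ℝ) :
    expMeasure r = volume.withDensity (exponentialPDF r) := rfl

lemma measurable_exponentialPDF (r : ℝ) : Measurable (exponentialPDF r) :=
  (measurable_exponentialPDFReal r).ennreal_ofReal

lemma expMeasure_absolutelyContinuous (r : ℝ) : expMeasure r ≪ volume :=
  withDensity_absolutelyContinuous _ _

instance (r : ℝ) : NullSingletonClass (expMeasure r) :=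
  ⟨fun x => expMeasure_absolutelyContinuous r (measure_singleton x)⟩

lemma expMeasure_Iic_zero (r : ℝ) : expMeasure r (Set.Iic 0) = 0 := by
  rw [← Set.Iio_union_right, measure_union_null_iff]
  refine ⟨?_, measure_singleton _⟩
  rw [expMeasure_eq_withDensity, withDensity_apply _ measurableSet_Iio,
    lintegral_exponentialPDF_of_nonpos le_rfl]

lemma ae_pos_expMeasure (r : ℝ) : ∀ᵐ x ∂expMeasure r, 0 < x := by
  rw [ae_iff]
  convert expMeasure_Iic_zero r using 2
  ext x; simp

/-- The exponential distribution is memoryless. -/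
lemma expMeasure_memoryless {r g : ℝ} (hg : 0 ≤ g) {A : Set ℝ} (hA : MeasurableSet A) :
    ENNReal.ofReal (Real.exp (-(r * g))) * expMeasure r {h | g + h ∈ A} =
      expMeasure r (A ∩ Set.Ici g) := by
  have hA' : MeasurableSet {h | g + h ∈ A} := (measurable_const_add g) hA
  rw [expMeasure_eq_withDensity, withDensity_apply _ hA',
    withDensity_apply _ (hA.inter measurableSet_Ici), ← lintegral_indicator hA',
    ← lintegral_indicator (hA.inter measurableSet_Ici), ← lintegral_const_mul',
    ← lintegral_add_left_eq_self ((A ∩ Set.Ici g).indicator (exponentialPDF r)) g]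
  · refine lintegral_congr fun h => ?_
    by_cases h1 : g + h ∈ A
    · by_cases h2 : 0 ≤ h
      · rw [Set.indicator_of_mem (by exact h1), Set.indicator_of_mem (by exact ⟨h1, by simpa⟩),
          exponentialPDF_of_nonneg h2, exponentialPDF_of_nonneg (by positivity),
          ← ENNReal.ofReal_mul (Real.exp_pos _).le]
        congr 1
        rw [mul_add, neg_add, Real.exp_add]; ring
      · rw [Set.indicator_of_mem (by exact h1),
          Set.indicator_of_notMem (fun h3 => h2 (by simpa using h3.2)),
          exponentialPDF_of_neg (not_le.1 h2), mul_zero]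
    · rw [Set.indicator_of_notMem (by exact h1),
        Set.indicator_of_notMem (fun h3 => h1 h3.1), mul_zero]
  · exact ENNReal.ofReal_ne_top

lemma expMeasure_Ici {r g : ℝ} (hr : 0 < r) (hg : 0 ≤ g) :
    expMeasure r (Set.Ici g) = ENNReal.ofReal (Real.exp (-(r * g))) := by
  have := isProbabilityMeasure_expMeasure hr
  simpa using (expMeasure_memoryless (r := r) hg MeasurableSet.univ).symm

/-- An exponential law of a larger rate has a density with respect to one of a smaller rate. -/
lemma lintegral_expMeasure_of_rate {r s : ℝ} (hr : 0 < r) (hs : 0 < s) {f : ℝ → ℝ≥0∞}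
    (hf : Measurable f) :
    ENNReal.ofReal (r / s) * ∫⁻ g, f g ∂expMeasure s =
      ∫⁻ g, ENNReal.ofReal (Real.exp (-((s - r) * g))) * f g ∂expMeasure r := by
  rw [expMeasure_eq_withDensity, expMeasure_eq_withDensity,
    lintegral_withDensity_eq_lintegral_mul _ (measurable_exponentialPDF s) hf,
    lintegral_withDensity_eq_lintegral_mul _ (measurable_exponentialPDF r) (by fun_prop),
    ← lintegral_const_mul' _ _ ENNReal.ofReal_ne_top]
  refine lintegral_congr fun g => ?_
  simp only [Pi.mul_apply]
  rcases lt_or_ge g 0 with h | h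
  · simp [exponentialPDF_of_neg h]
  · rw [exponentialPDF_of_nonneg h, exponentialPDF_of_nonneg h, ← mul_assoc, ← mul_assoc,
      ← ENNReal.ofReal_mul (by positivity), ← ENNReal.ofReal_mul (by positivity)]
    congr 2
    rw [sub_mul, neg_sub, mul_assoc, ← Real.exp_add]
    field_simp
    ring_nf

/-! ### Prepending to an i.i.d. sequence -/

/-- The sequence with first element `a`, followed by the sequence `z`. -/
def cons {α : Type*} (a : α) (z : ℕ → α) (n : ℕ) : α := Nat.casesOn n a z

@[simp] lemma cons_zero {α : Type*} (a : α) (z : ℕ → α) : cons a z 0 = a := rfl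
@[simp] lemma cons_succ {α : Type*} (a : α) (z : ℕ → α) (n : ℕ) : cons a z (n + 1) = z n := rfl

@[fun_prop]
lemma measurable_cons {α β : Type*} [MeasurableSpace α] [MeasurableSpace β] {f : β → α}
    {g : β → ℕ → α} (hf : Measurable f) (hg : Measurable g) :
    Measurable fun b => cons (f b) (g b) := by
  refine measurable_pi_iff.2 fun n => ?_
  cases n with
  | zero => exact hf
  | succ n => exact (measurable_pi_apply n).comp hg

/-- Product measures are determined by cylinders, and a cylinder over an initial segment of indices
splits into a condition on the head and one on the tail. -/
lemma map_cons_infinitePi {α : Type*} [MeasurableSpace α] (β : Measure α)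
    [IsProbabilityMeasure β] :
    (β.prod (Measure.infinitePi fun _ : ℕ => β)).map (fun p => cons p.1 p.2) =
      Measure.infinitePi fun _ : ℕ => β := by
  classical
  refine Measure.eq_infinitePi _ fun s t ht => ?_
  obtain ⟨n, hn⟩ : ∃ n, s ⊆ Finset.range (n + 1) :=
    ⟨s.sup id, fun i hi => Finset.mem_range_succ_iff.2 (Finset.le_sup (f := id) hi)⟩
  -- Padding with `univ` turns the index set into an initial segment, which contains `0`, without
  -- changing the cylinder.
  set t' : ℕ → Set α := fun i => if i ∈ s then t i else Set.univ with ht'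
  have mt' : ∀ i, MeasurableSet (t' i) := fun i => by
    simp only [ht']; split_ifs; exacts [ht i, .univ]
  have h1 : (Set.pi s t) = Set.pi (Finset.range (n + 1)) t' := by
    ext z
    simp only [Set.mem_pi, Finset.mem_coe, ht']
    constructor
    · intro h i _
      split_ifs with hi
      exacts [h i hi, trivial]
    · intro h i hi
      simpa [hi] using h i (hn hi)
  have h2 : ∏ i ∈ s, β (t i) = ∏ i ∈ Finset.range (n + 1), β (t' i) := by
    rw [← Finset.prod_subset hn]
    · exact Finset.prod_congr rfl fun i hi => by simp [ht', hi]
    · intro i _ hi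
      simp [ht', hi]
  have h3 : (fun p : α × (ℕ → α) => cons p.1 p.2) ⁻¹' Set.pi (Finset.range (n + 1)) t' =
      t' 0 ×ˢ Set.pi (Finset.range n) (fun i => t' (i + 1)) := by
    ext p
    simp only [Set.mem_preimage, Set.mem_pi, Finset.mem_coe, Finset.mem_range, Set.mem_prod]
    constructor
    · exact fun h => ⟨h 0 (Nat.succ_pos _), fun i hi => h (i + 1) (by omega)⟩
    · rintro ⟨h0, h⟩ i hi
      cases i with
      | zero => exact h0
      | succ i => exact h i (by omega)
  rw [h1, h2, Measure.map_apply (by fun_prop)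
    (MeasurableSet.pi (Finset.countable_toSet _) fun i _ => mt' i), h3, Measure.prod_prod,
    Measure.infinitePi_pi _ (fun i _ => mt' _), Finset.prod_range_succ', mul_comm]

/-! ### The law of the input, decomposed at the first update -/

/-- The inter-arrival and service times of the updates of one source. -/
abbrev Updates := ℕ → ℝ × ℝ

/-- The inter-arrival and service times of the updates of `N` sources. -/
abbrev Input (N : ℕ) := Fin N → Updates

/-- The law of the updates of each source `j` is that of a sequence whose first entry is
distributed as `expMeasure (rate j) ⊗ ν`, and followed by an independent copy of the sequence. -/
structure IsUpdatesLaw {N : ℕ} (rate : Fin N → ℝ) (ν : Measure ℝ)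
    (α : Fin N → Measure Updates) : Prop where
  rate_pos : ∀ j, 0 < rate j
  map_cons : ∀ j, (((expMeasure (rate j)).prod ν).prod (α j)).map (fun p => cons p.1 p.2) = α j

/-- All updates arrive later by the amount `g`. -/
def delay (g : ℝ) (z : Updates) : Updates :=
  cons (g + (z 0).1, (z 0).2) fun n => z (n + 1)

/-- The input in which the first update of all arrives at time `g`, belongs to source `w.1.1` and
requires the service time `w.1.2`, and what follows that update is `w.2`. -/
def prepend {N : ℕ} (g : ℝ) (w : (Fin N × ℝ) × Input N) : Input N := fun l =>
  if l = w.1.1 then cons (g, w.1.2) (w.2 l) else delay g (w.2 l)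

/-- The law of the source of the first update. -/
noncomputable def sourceLaw {N : ℕ} (rate : Fin N → ℝ) : Measure (Fin N) :=
  ∑ j, ENNReal.ofReal (rate j / ∑ l, rate l) • Measure.dirac j

lemma measurable_fst_apply (n : ℕ) : Measurable fun z : Updates => (z n).1 := by fun_prop

@[fun_prop]
lemma measurable_delay {β : Type*} [MeasurableSpace β] {f : β → ℝ}
    {g : β → Updates} (hf : Measurable f) (hg : Measurable g) :
    Measurable fun b => delay (f b) (g b) := by
  unfold delay; fun_prop

lemma measurable_prepend {N : ℕ} :
    Measurable fun p : ℝ × (Fin N × ℝ) × Input N => prepend p.1 p.2 := by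
  refine measurable_pi_iff.2 fun l => ?_
  unfold prepend
  refine Measurable.ite ?_ (by fun_prop) (by fun_prop)
  exact measurableSet_eq_fun measurable_const (by fun_prop)

lemma lintegral_sourceLaw {N : ℕ} (rate : Fin N → ℝ) (f : Fin N → ℝ≥0∞) :
    ∫⁻ j, f j ∂sourceLaw rate = ∑ j, ENNReal.ofReal (rate j / ∑ l, rate l) * f j := by
  simp [sourceLaw]

section

variable {N : ℕ} {rate : Fin N → ℝ} {ν : Measure ℝ} {α : Fin N → Measure Updates}

lemma IsUpdatesLaw.isProbabilityMeasure_interarrival (h : IsUpdatesLaw rate ν α) (j : Fin N) :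
    IsProbabilityMeasure (expMeasure (rate j)) :=
  ProbabilityTheory.isProbabilityMeasure_expMeasure (h.rate_pos j)

lemma IsUpdatesLaw.sum_pos (h : IsUpdatesLaw rate ν α) (j : Fin N) : 0 < ∑ l, rate l :=
  Finset.sum_pos (fun l _ => h.rate_pos l) ⟨j, Finset.mem_univ j⟩

lemma IsUpdatesLaw.isProbabilityMeasure_sourceLaw (h : IsUpdatesLaw rate ν α) (j : Fin N) :
    IsProbabilityMeasure (sourceLaw rate) := by
  constructor
  rw [← lintegral_one, lintegral_sourceLaw]
  simp only [mul_one]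
  have := h.sum_pos j
  rw [← ENNReal.ofReal_sum_of_nonneg fun l _ => div_nonneg (h.rate_pos l).le this.le,
    ← Finset.sum_div, div_self this.ne', ENNReal.ofReal_one]

variable [IsProbabilityMeasure ν] [∀ j, IsProbabilityMeasure (α j)]

lemma IsUpdatesLaw.map_fst (h : IsUpdatesLaw rate ν α) (j : Fin N) :
    (α j).map (fun z => (z 0).1) = expMeasure (rate j) := by
  have := h.isProbabilityMeasure_interarrival j
  conv_lhs => rw [← h.map_cons j]
  rw [Measure.map_map (by fun_prop) (by fun_prop)]
  change Measure.map (Prod.fst ∘ Prod.fst) _ = _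
  rw [← Measure.map_map (by fun_prop) (by fun_prop), Measure.map_fst_prod, measure_univ, one_smul,
    Measure.map_fst_prod, measure_univ, one_smul]

lemma IsUpdatesLaw.ae_pos (h : IsUpdatesLaw rate ν α) (j : Fin N) :
    ∀ᵐ z ∂α j, ∀ n, 0 < (z n).1 := by
  have := h.isProbabilityMeasure_interarrival j
  rw [ae_all_iff]
  intro n
  have ms : ∀ n, MeasurableSet {z : Updates | 0 < (z n).1} := fun n =>
    measurableSet_lt measurable_const (by fun_prop)
  induction n with
  | zero =>
    have := ae_pos_expMeasure (rate j)
    rw [← h.map_fst j] at this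
    exact ae_of_ae_map (measurable_fst_apply 0).aemeasurable this
  | succ n ih =>
    rw [← h.map_cons j, ae_map_iff (by fun_prop) (ms _)]
    -- Entry `n + 1` of a sequence is entry `n` of its tail, which has the same law.
    exact Measure.quasiMeasurePreserving_snd.ae ih

/-- Memorylessness for a whole source: a source that is silent until `g` starts afresh there. With
the first service time and the tail fixed, this is `expMeasure_memoryless`. -/
lemma IsUpdatesLaw.delay_apply (h : IsUpdatesLaw rate ν α) (j : Fin N) {g : ℝ} (hg : 0 ≤ g)
    {C : Set Updates} (hC : MeasurableSet C) :
    ENNReal.ofReal (Real.exp (-(rate j * g))) * α j {z | delay g z ∈ C} =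
      α j (C ∩ {z | g ≤ (z 0).1}) := by
  have := h.isProbabilityMeasure_interarrival j
  have m1 : MeasurableSet {z | delay g z ∈ C} :=
    (measurable_delay measurable_const measurable_id) hC
  have m2 : MeasurableSet (C ∩ {z : Updates | g ≤ (z 0).1}) :=
    hC.inter (measurableSet_le measurable_const (by fun_prop))
  have mc : Measurable fun p : (ℝ × ℝ) × Updates => cons p.1 p.2 := by fun_prop
  conv_lhs => rw [← h.map_cons j]
  conv_rhs => rw [← h.map_cons j]
  rw [Measure.map_apply mc m1, Measure.map_apply mc m2, Measure.prod_apply_symm (mc m1),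
    Measure.prod_apply_symm (mc m2), ← lintegral_const_mul' _ _ ENNReal.ofReal_ne_top]
  refine lintegral_congr fun z => ?_
  have mz : Measurable fun x : ℝ × ℝ => (x, z) := by fun_prop
  rw [Measure.prod_apply_symm (mz (mc m1)), Measure.prod_apply_symm (mz (mc m2)),
    ← lintegral_const_mul' _ _ ENNReal.ofReal_ne_top]
  refine lintegral_congr fun s => ?_
  exact expMeasure_memoryless hg (A := {x | cons (x, s) z ∈ C})
    ((by fun_prop : Measurable fun x : ℝ => cons (x, s) z) hC)

/-- Resampling one coordinate preserves a product law; this serves to condition on source `j` by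
Fubini without splitting the product type. -/
lemma map_update_pi {ι : Type*} [Fintype ι] [DecidableEq ι] {X : ι → Type*}
    [∀ i, MeasurableSpace (X i)] (α : ∀ i, Measure (X i)) [∀ i, IsProbabilityMeasure (α i)]
    (j : ι) :
    ((α j).prod (Measure.pi α)).map (fun p => Function.update p.2 j p.1) = Measure.pi α := by
  have hm : Measurable fun p : X j × (∀ i, X i) => Function.update p.2 j p.1 := by
    refine measurable_pi_iff.2 fun l => ?_
    by_cases hl : l = j
    · subst hl; simpa using measurable_fst
    · simp only [Function.update_of_ne hl]; fun_prop
  refine (Measure.pi_eq fun C hC => ?_).symm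
  rw [Measure.map_apply hm (MeasurableSet.univ_pi hC)]
  have : (fun p : X j × (∀ i, X i) => Function.update p.2 j p.1) ⁻¹' Set.univ.pi C =
      C j ×ˢ Set.univ.pi (Function.update C j Set.univ) := by
    ext p
    simp only [Set.mem_preimage, Set.mem_univ_pi, Set.mem_prod]
    constructor
    · intro h
      refine ⟨by simpa using h j, fun l => ?_⟩
      by_cases hl : l = j
      · subst hl; simp
      · simpa [Function.update_of_ne hl] using h l
    · rintro ⟨h1, h2⟩ l
      by_cases hl : l = j
      · subst hl; simpa using h1
      · simpa [Function.update_of_ne hl] using h2 l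
  rw [this, Measure.prod_prod, Measure.pi_pi, ← Finset.mul_prod_erase _ _ (Finset.mem_univ j),
    ← Finset.mul_prod_erase (Finset.univ) (fun i => α i (C i)) (Finset.mem_univ j)]
  simp only [Function.update_self, measure_univ, one_mul]
  congr 1
  refine Finset.prod_congr rfl fun l hl => ?_
  rw [Function.update_of_ne (Finset.ne_of_mem_erase hl)]

lemma IsUpdatesLaw.ae_ne (h : IsUpdatesLaw rate ν α) {j l : Fin N} (hjl : j ≠ l) :
    ∀ᵐ e ∂Measure.pi α, (e j 0).1 ≠ (e l 0).1 := by
  have := h.isProbabilityMeasure_interarrival j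
  have := h.isProbabilityMeasure_interarrival l
  have m : ∀ k, Measurable fun e : Input N => (e k 0).1 := fun k => by fun_prop
  have h1 : (Measure.pi α).map (fun e => ((e j 0).1, (e l 0).1)) =
      (expMeasure (rate j)).prod (expMeasure (rate l)) := by
    have := (iIndepFun_pi (μ := α) (X := fun _ (z : Updates) => (z 0).1)
      (fun _ => (measurable_fst_apply 0).aemeasurable)).indepFun hjl
    rw [(indepFun_iff_map_prod_eq_prod_map_map (m j).aemeasurable (m l).aemeasurable).1 this]
    congr 1
    · rw [← h.map_fst j, ← (measurePreserving_eval α j).map_eq,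
        Measure.map_map (by fun_prop) (by fun_prop)]
      rfl
    · rw [← h.map_fst l, ← (measurePreserving_eval α l).map_eq,
        Measure.map_map (by fun_prop) (by fun_prop)]
      rfl
  have h2 : ∀ᵐ p ∂(expMeasure (rate j)).prod (expMeasure (rate l)), p.1 ≠ p.2 := by
    rw [Measure.ae_prod_iff_ae_ae]
    · refine Filter.Eventually.of_forall fun x => ?_
      rw [ae_iff]
      simp only [not_not, ne_eq]
      convert measure_singleton (μ := expMeasure (rate l)) x using 2
      ext y; exact eq_comm
    · exact (measurableSet_eq_fun measurable_fst measurable_snd).compl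
  rw [← h1] at h2
  exact ae_of_ae_map ((m j).prodMk (m l)).aemeasurable h2

/-- Some source is always the first, and ties have probability zero, so the events that `j` is first
form a partition up to null sets. -/
lemma IsUpdatesLaw.sum_first (h : IsUpdatesLaw rate ν α) (j₀ : Fin N) {B : Set (Input N)}
    (hB : MeasurableSet B) :
    ∑ j, Measure.pi α (B ∩ {e | ∀ l, (e j 0).1 ≤ (e l 0).1}) = Measure.pi α B := by
  have : Nonempty (Fin N) := ⟨j₀⟩
  have hm : ∀ j : Fin N, MeasurableSet (B ∩ {e | ∀ l, (e j 0).1 ≤ (e l 0).1}) := fun j => by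
    refine hB.inter ?_
    rw [Set.ofPred_forall]
    exact MeasurableSet.iInter fun l => measurableSet_le (by fun_prop) (by fun_prop)
  rw [← tsum_fintype (L := .unconditional _), ← measure_iUnion₀]
  · congr 1
    ext e
    simp only [Set.mem_iUnion, Set.mem_inter_iff, exists_and_left, and_iff_left_iff_imp]
    exact fun _ => Finite.exists_min fun j => (e j 0).1
  · intro j l hjl
    refine measure_mono_null ?_ (ae_iff.1 (h.ae_ne hjl))
    rintro e ⟨h1, h2⟩
    simpa using le_antisymm (h1.2 l) (h2.2 j)
  · exact fun j => (hm j).nullMeasurableSet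

/-- The law of the input is that of an input whose first update arrives after a time that is
exponentially distributed with the total rate, comes from an independently chosen source, and is
followed by an independent copy of the input. -/
theorem IsUpdatesLaw.map_prepend (h : IsUpdatesLaw rate ν α) (j₀ : Fin N) :
    ((expMeasure (∑ l, rate l)).prod (((sourceLaw rate).prod ν).prod (Measure.pi α))).map
      (fun p => prepend p.1 p.2) = Measure.pi α := by
  have i1 := h.isProbabilityMeasure_interarrival
  have i2 := h.isProbabilityMeasure_sourceLaw j₀
  have i3 := ProbabilityTheory.isProbabilityMeasure_expMeasure (h.sum_pos j₀)
  refine (Measure.pi_eq fun C hC => ?_).symm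
  have mB : MeasurableSet (Set.univ.pi C) := MeasurableSet.univ_pi hC
  have mg : ∀ g : ℝ, Measurable fun w : (Fin N × ℝ) × Input N => (g, w) := fun g => by fun_prop
  have mQ := measurable_prepend mB
  rw [Measure.map_apply measurable_prepend mB, Measure.prod_apply mQ, ← Measure.pi_pi,
    ← h.sum_first j₀ mB]
  -- For fixed `g`, `j`, `s` prepending acts on each source separately, so the probability of a box
  -- factors.
  have key : ∀ (j : Fin N) (g s : ℝ), Measure.pi α {e | prepend g ((j, s), e) ∈ Set.univ.pi C} =
      α j {z | cons (g, s) z ∈ C j} *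
        ∏ l ∈ Finset.univ.erase j, α l {z | delay g z ∈ C l} := by
    intro j g s
    have : {e | prepend g ((j, s), e) ∈ Set.univ.pi C} = Set.univ.pi fun l =>
        {z | (if l = j then cons (g, s) z else delay g z) ∈ C l} := by
      ext e; simp [prepend]
    rw [this, Measure.pi_pi, ← Finset.mul_prod_erase _ _ (Finset.mem_univ j)]
    congr 1
    · simp
    · refine Finset.prod_congr rfl fun l hl => ?_
      simp [Finset.ne_of_mem_erase hl]
  have mF : ∀ j, Measurable fun p : ℝ × ℝ =>
      Measure.pi α {e | prepend p.1 ((j, p.2), e) ∈ Set.univ.pi C} := fun j =>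
    measurable_measure_prodMk_left ((measurable_prepend.comp
      (by fun_prop : Measurable fun q : (ℝ × ℝ) × Input N => (q.1.1, (j, q.1.2), q.2))) mB)
  have mI : ∀ j, Measurable fun g : ℝ =>
      ∫⁻ s, Measure.pi α {e | prepend g ((j, s), e) ∈ Set.univ.pi C} ∂ν := fun j =>
    (mF j).lintegral_prod_right'
  calc ∫⁻ g, (((sourceLaw rate).prod ν).prod (Measure.pi α))
        (Prod.mk g ⁻¹' ((fun p => prepend p.1 p.2) ⁻¹' Set.univ.pi C)) ∂expMeasure (∑ l, rate l)
      = ∫⁻ g, ∑ j, ENNReal.ofReal (rate j / ∑ l, rate l) *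
          ∫⁻ s, Measure.pi α {e | prepend g ((j, s), e) ∈ Set.univ.pi C} ∂ν
          ∂expMeasure (∑ l, rate l) := by
        refine lintegral_congr fun g => ?_
        rw [Measure.prod_apply ((mg g) mQ), lintegral_prod _
          (measurable_measure_prodMk_left ((mg g) mQ)).aemeasurable, lintegral_sourceLaw]
        rfl
    _ = ∑ j, ENNReal.ofReal (rate j / ∑ l, rate l) *
          ∫⁻ g, ∫⁻ s, Measure.pi α {e | prepend g ((j, s), e) ∈ Set.univ.pi C} ∂ν
          ∂expMeasure (∑ l, rate l) := by
        rw [lintegral_finsetSum _ fun j _ => (mI j).const_mul _]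
        exact Finset.sum_congr rfl fun j _ => lintegral_const_mul _ (mI j)
    _ = _ := Finset.sum_congr rfl fun j _ => ?_
  -- It remains to match, for each `j`, the term with first source `j`. The weight `λ_j/λ` trades
  -- `Exp(λ)` for `Exp(λ_j)` at the price of the factor `exp(-(λ - λ_j) g)`, the probability that
  -- all other sources are silent until `g`.
  rw [lintegral_expMeasure_of_rate (h.rate_pos j) (h.sum_pos j₀) (mI j)]
  set G : ℝ → ℝ≥0∞ := fun g =>
    ∏ l ∈ Finset.univ.erase j, α l (C l ∩ {z | g ≤ (z 0).1}) with hG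
  have mG : Measurable G := by
    refine Finset.measurable_prod _ fun l _ => ?_
    exact measurable_measure_prodMk_left (s := {q : ℝ × Updates | q.2 ∈ C l ∧ q.1 ≤ (q.2 0).1})
      ((measurable_snd (hC l)).inter
        (measurableSet_le measurable_fst ((measurable_fst_apply 0).comp measurable_snd)))
  have mJ : Measurable fun z : Updates => (C j).indicator 1 z * G (z 0).1 :=
    (measurable_one.indicator (hC j)).mul (by fun_prop)
  -- The silence factor splits into one factor per source `l ≠ j`, and `delay_apply` absorbs each of
  -- them, which produces `G g`.
  have e1 : ∀ᵐ g ∂expMeasure (rate j), ENNReal.ofReal (Real.exp (-((∑ l, rate l - rate j) * g))) *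
      ∫⁻ s, Measure.pi α {e | prepend g ((j, s), e) ∈ Set.univ.pi C} ∂ν =
      ∫⁻ s, ∫⁻ z, (C j).indicator 1 (cons (g, s) z) * G g ∂α j ∂ν := by
    filter_upwards [ae_pos_expMeasure (rate j)] with g hg
    rw [← lintegral_const_mul' _ _ ENNReal.ofReal_ne_top]
    refine lintegral_congr fun s => ?_
    have mc : Measurable fun z : Updates => cons (g, s) z := by fun_prop
    have mi : Measurable fun z => (C j).indicator (1 : Updates → ℝ≥0∞) (cons (g, s) z) :=
      (measurable_one.indicator (hC j)).comp mc
    rw [key, mul_left_comm, lintegral_mul_const _ mi]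
    congr 1
    · exact (lintegral_indicator_one (mc (hC j))).symm
    · have : ENNReal.ofReal (Real.exp (-((∑ l, rate l - rate j) * g))) =
          ∏ l ∈ Finset.univ.erase j, ENNReal.ofReal (Real.exp (-(rate l * g))) := by
        rw [← ENNReal.ofReal_prod_of_nonneg fun l _ => (Real.exp_pos _).le, ← Real.exp_sum]
        congr 2
        rw [← Finset.add_sum_erase _ _ (Finset.mem_univ j), Finset.sum_neg_distrib,
          ← Finset.sum_mul]
        ring
      rw [this, ← Finset.prod_mul_distrib]
      exact Finset.prod_congr rfl fun l _ => h.delay_apply l hg.le (hC l)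
  have mU : MeasurableSet (Set.univ.pi C ∩ {e | ∀ l, (e j 0).1 ≤ (e l 0).1}) := by
    refine mB.inter ?_
    rw [Set.ofPred_forall]
    exact MeasurableSet.iInter fun l => measurableSet_le (by fun_prop) (by fun_prop)
  have hm : Measurable fun p : Updates × Input N => Function.update p.2 j p.1 := by
    refine measurable_pi_iff.2 fun l => ?_
    by_cases hl : l = j
    · subst hl; simpa using measurable_fst
    · simp only [Function.update_of_ne hl]; fun_prop
  -- Given the updates of source `j`, the other sources are independent, and each must stay in its
  -- set and start no earlier; this is again `G`.
  have e2 : Measure.pi α (Set.univ.pi C ∩ {e | ∀ l, (e j 0).1 ≤ (e l 0).1}) =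
      ∫⁻ z, (C j).indicator 1 z * G (z 0).1 ∂α j := by
    conv_lhs => rw [← map_update_pi α j]
    rw [Measure.map_apply hm mU, Measure.prod_apply (hm mU)]
    refine lintegral_congr fun z => ?_
    by_cases hz : z ∈ C j
    · rw [Set.indicator_of_mem hz, Pi.one_apply, one_mul]
      have : Prod.mk z ⁻¹' ((fun p : Updates × Input N => Function.update p.2 j p.1) ⁻¹'
          (Set.univ.pi C ∩ {e | ∀ l, (e j 0).1 ≤ (e l 0).1})) = Set.univ.pi fun l =>
            if l = j then Set.univ else C l ∩ {y | (z 0).1 ≤ (y 0).1} := by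
        ext e
        simp only [Set.mem_preimage, Set.mem_inter_iff, Set.mem_univ_pi, Set.mem_ofPred_eq,
          Function.update_self]
        constructor
        · rintro ⟨h1, h2⟩ l
          by_cases hl : l = j
          · simp [hl]
          · have := h1 l
            have := h2 l
            simp_all
        · intro h1
          refine ⟨fun l => ?_, fun l => ?_⟩ <;> by_cases hl : l = j
          · subst hl; simpa using hz
          · have := h1 l; simp_all
          · subst hl; simp
          · have := h1 l; simp_all
      rw [this, Measure.pi_pi, ← Finset.mul_prod_erase _ _ (Finset.mem_univ j)]
      simp only [if_true, measure_univ, one_mul, hG]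
      exact Finset.prod_congr rfl fun l hl => by rw [if_neg (Finset.ne_of_mem_erase hl)]
    · rw [Set.indicator_of_notMem hz, zero_mul]
      convert measure_empty (μ := Measure.pi α)
      ext e
      simp only [Set.mem_preimage, Set.mem_inter_iff, Set.mem_univ_pi, Set.mem_empty_iff_false,
        iff_false, not_and]
      exact fun h1 => absurd (by simpa using h1 j) hz
  have mc : Measurable fun p : (ℝ × ℝ) × Updates => cons p.1 p.2 := by fun_prop
  have e3 : ∫⁻ z, (C j).indicator 1 z * G (z 0).1 ∂α j =
      ∫⁻ g, ∫⁻ s, ∫⁻ z, (C j).indicator 1 (cons (g, s) z) * G g ∂α j ∂ν ∂expMeasure (rate j) := by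
    conv_lhs => rw [← h.map_cons j]
    have mJ' : Measurable fun p : (ℝ × ℝ) × Updates =>
      (C j).indicator 1 (cons p.1 p.2) * G (cons p.1 p.2 0).1 := mJ.comp mc
    rw [lintegral_map mJ mc, lintegral_prod _ mJ'.aemeasurable,
      lintegral_prod _ mJ'.lintegral_prod_right'.aemeasurable]
    rfl
  rw [lintegral_congr_ae e1, e2, e3]

end

/-! ### The law of the random input -/

/-- The law with density `f`. -/
noncomputable def densityLaw (f : ℝ → ℝ) : Measure ℝ :=
  volume.withDensity fun x => ENNReal.ofReal (f x)

/-- The realization of the input variables. -/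
def toInput {Ω : Type*} {N : ℕ} (X S : Fin N → ℕ → Ω → ℝ) (ω : Ω) : Input N :=
  fun j n => (X j n ω, S j n ω)

lemma isProbabilityMeasure_densityLaw {Ω : Type*} [MeasurableSpace Ω] {P : Measure Ω}
    [IsProbabilityMeasure P] {X : Ω → ℝ} {f : ℝ → ℝ} (h : IsPDF P X f) :
    IsProbabilityMeasure (densityLaw f) := by
  rw [densityLaw, ← h.map_eq]
  exact Measure.isProbabilityMeasure_map h.aemeasurable

/-- Reindexing the independent family by `ι × Bool` and currying groups the two variables that
belong to the same `p`. -/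
lemma map_pair_eq_infinitePi {Ω ι : Type*} [MeasurableSpace Ω] {P : Measure Ω}
    {X S : ι → Ω → ℝ} (hX : ∀ p, Measurable (X p)) (hS : ∀ p, Measurable (S p))
    (μ ν : ι → Measure ℝ) [∀ p, IsProbabilityMeasure (μ p)] [∀ p, IsProbabilityMeasure (ν p)]
    (hμ : ∀ p, P.map (X p) = μ p) (hν : ∀ p, P.map (S p) = ν p)
    (hind : iIndepFun (fun z : ι ⊕ ι => Sum.elim X S z) P) :
    P.map (fun ω p => (X p ω, S p ω)) = Measure.infinitePi fun p => (μ p).prod (ν p) := by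
  set κ : ι → Bool → Measure ℝ := fun p b => bif b then μ p else ν p with hκ
  have : ∀ p b, IsProbabilityMeasure (κ p b) := fun p b => by
    cases b <;> simp only [hκ, cond_true, cond_false] <;> infer_instance
  set f : ι × Bool → ι ⊕ ι := fun q => bif q.2 then Sum.inl q.1 else Sum.inr q.1 with hf
  have inj : Function.Injective f := by
    rintro ⟨p, b⟩ ⟨p', b'⟩ h
    cases b <;> cases b' <;> simp_all
  have hm : ∀ q, Measurable (Sum.elim X S (f q)) := by
    rintro ⟨p, b⟩
    cases b
    exacts [hS p, hX p]
  have h1 := (hind.precomp inj).map_fun_eq_infinitePi_map hm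
  have h2 : (fun q => P.map (Sum.elim X S (f q))) = fun q => κ q.1 q.2 := by
    funext ⟨p, b⟩
    cases b
    exacts [hν p, hμ p]
  have h3 : P.map (fun ω q => Sum.elim X S (f q) ω) = Measure.infinitePi fun q => κ q.1 q.2 := by
    have h4 : ∀ (ρ : ι × Bool → Measure ℝ) [∀ q, IsProbabilityMeasure (ρ q)],
      (fun q => P.map (Sum.elim X S (f q))) = ρ →
        P.map (fun ω q => Sum.elim X S (f q) ω) = Measure.infinitePi ρ := by
      rintro ρ _ rfl
      exact h1
    exact h4 _ h2
  have h5 : ∀ p, (Measure.infinitePi fun b => κ p b).map (fun x => (x true, x false)) =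
      (μ p).prod (ν p) := fun p =>
    Measure.infinitePi_map_eval_prod (P := fun b => κ p b) (by decide : true ≠ false)
  have hp : ∀ p : ι, Measurable fun x : Bool → ℝ => (x true, x false) := fun _ => by fun_prop
  have h6 := Measure.infinitePi_map_pi (μ := fun p => Measure.infinitePi fun b => κ p b)
    (f := fun _ (x : Bool → ℝ) => (x true, x false)) hp
  simp only [h5] at h6
  rw [← h6, ← Measure.infinitePi_map_curry κ, ← h3,
    Measure.map_map (by fun_prop) (measurable_pi_iff.2 hm),
    Measure.map_map (by fun_prop) ((by fun_prop : Measurable _).comp (measurable_pi_iff.2 hm))]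
  rfl

lemma IsInput.measurable_toInput {Ω : Type*} [MeasurableSpace Ω] {P : Measure Ω} {N : ℕ}
    {rate : Fin N → ℝ} {fS : ℝ → ℝ} {X S : Fin N → ℕ → Ω → ℝ} (h : IsInput P rate fS X S) :
    Measurable (toInput X S) :=
  measurable_pi_iff.2 fun j => measurable_pi_iff.2 fun n =>
    (h.measurable_interarrival j n).prodMk (h.measurable_service j n)

theorem IsInput.exists_updatesLaw {Ω : Type*} [MeasurableSpace Ω] {P : Measure Ω}
    [IsProbabilityMeasure P] {N : ℕ} {rate : Fin N → ℝ} {fS : ℝ → ℝ} {X S : Fin N → ℕ → Ω → ℝ}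
    (h : IsInput P rate fS X S) (i : Fin N) :
    ∃ α : Fin N → Measure Updates, (∀ j, IsProbabilityMeasure (α j)) ∧
      IsUpdatesLaw rate (densityLaw fS) α ∧ P.map (toInput X S) = Measure.pi α := by
  have i1 := isProbabilityMeasure_densityLaw (h.service_pdf i 0)
  have i2 := fun j => isProbabilityMeasure_expMeasure (h.rate_pos j)
  refine ⟨fun j => Measure.infinitePi fun _ => (expMeasure (rate j)).prod (densityLaw fS),
    fun j => inferInstance, ⟨h.rate_pos, fun j => map_cons_infinitePi _⟩, ?_⟩
  have h1 := map_pair_eq_infinitePi (P := P) (ι := Fin N × ℕ) (X := fun p => X p.1 p.2)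
    (S := fun p => S p.1 p.2) (fun p => h.measurable_interarrival _ _)
    (fun p => h.measurable_service _ _) (fun p => expMeasure (rate p.1)) (fun _ => densityLaw fS)
    (fun p => h.interarrival_law _ _) (fun p => (h.service_pdf _ _).map_eq) h.indep
  have h2 := Measure.infinitePi_map_curry
    (fun (j : Fin N) (_ : ℕ) => (expMeasure (rate j)).prod (densityLaw fS))
  rw [← Measure.infinitePi_eq_pi, ← h2, ← h1, Measure.map_map (by fun_prop)]
  · rfl
  · exact measurable_pi_iff.2 fun p =>
      (h.measurable_interarrival _ _).prodMk (h.measurable_service _ _)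

/-! ### The received updates before and after the first arrival -/

/-- The inter-arrival times of an input. -/
def interarrival {N : ℕ} (j : Fin N) (n : ℕ) (e : Input N) : ℝ := (e j n).1

/-- The service times of an input. -/
def service {N : ℕ} (j : Fin N) (n : ℕ) (e : Input N) : ℝ := (e j n).2

/-- All inter-arrival times are positive. -/
def PosInterarrival {N : ℕ} (e : Input N) : Prop := ∀ j n, 0 < interarrival j n e

/-- No update arrives before time `s`. -/
def NoArrivalBefore {N : ℕ} (s : ℝ) (e : Input N) : Prop :=
  ∀ l m, s ≤ arrival interarrival l m e

/-- Infinitely many updates of source `i` are received. -/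
def InfReceived {N : ℕ} (i : Fin N) (e : Input N) : Prop :=
  {n | Received interarrival service i n e}.Infinite

section Pathwise

variable {N : ℕ} {i j l : Fin N} {g s : ℝ} {e : Input N}

lemma arrival_zero (l : Fin N) (e : Input N) : arrival interarrival l 0 e = (e l 0).1 := by
  simp [arrival, interarrival]

lemma arrival_succ (l : Fin N) (m : ℕ) (e : Input N) :
    arrival interarrival l (m + 1) e = arrival interarrival l m e + (e l (m + 1)).1 :=
  Finset.sum_range_succ _ _

lemma PosInterarrival.arrival_pos (he : PosInterarrival e) (l : Fin N) (m : ℕ) :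
    0 < arrival interarrival l m e :=
  Finset.sum_pos (fun k _ => he l k) ⟨0, by simp⟩

lemma arrival_prepend_of_ne (hl : l ≠ j) (m : ℕ) :
    arrival interarrival l m (prepend g ((j, s), e)) = g + arrival interarrival l m e := by
  induction m with
  | zero => simp [arrival_zero, prepend, hl, delay]
  | succ m ih => rw [arrival_succ, ih, arrival_succ]; simp [prepend, hl, delay, add_assoc]

lemma arrival_prepend_zero : arrival interarrival j 0 (prepend g ((j, s), e)) = g := by
  simp [arrival_zero, prepend]

lemma arrival_prepend_succ (m : ℕ) :
    arrival interarrival j (m + 1) (prepend g ((j, s), e)) = g + arrival interarrival j m e := by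
  induction m with
  | zero => simp [arrival_succ, arrival_zero, prepend]
  | succ m ih => rw [arrival_succ, ih, arrival_succ]; simp [prepend, add_assoc]

lemma service_prepend_of_ne (hl : l ≠ j) (m : ℕ) :
    service l m (prepend g ((j, s), e)) = service l m e := by
  cases m <;> simp [service, prepend, hl, delay]

lemma service_prepend_zero : service j 0 (prepend g ((j, s), e)) = s := by
  simp [service, prepend]

lemma service_prepend_succ (m : ℕ) :
    service j (m + 1) (prepend g ((j, s), e)) = service j m e := by
  simp [service, prepend]

/-- The arrival moments after prepending are `g` and the old ones shifted by `g`. In this form the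
numbering of the updates disappears. -/
lemma exists_arrival_prepend (Q : ℝ → Prop) :
    (∃ l m, Q (arrival interarrival l m (prepend g ((j, s), e)))) ↔
      Q g ∨ ∃ l m, Q (g + arrival interarrival l m e) := by
  constructor
  · rintro ⟨l, m, h⟩
    by_cases hl : l = j
    · subst hl
      cases m with
      | zero => exact .inl (by rwa [arrival_prepend_zero] at h)
      | succ m => exact .inr ⟨_, m, by rwa [arrival_prepend_succ] at h⟩
    · exact .inr ⟨_, m, by rwa [arrival_prepend_of_ne hl] at h⟩
  · rintro (h | ⟨l, m, h⟩)
    · exact ⟨j, 0, by rwa [arrival_prepend_zero]⟩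
    · by_cases hl : l = j
      · subst hl; exact ⟨_, m + 1, by rwa [arrival_prepend_succ]⟩
      · exact ⟨l, m, by rwa [arrival_prepend_of_ne hl]⟩

/-- The prepended update arrives before all others, so it cannot interrupt any of them, and the rest
is translation invariant. -/
lemma received_prepend_of_ne (he : PosInterarrival e) (hl : l ≠ j) (n : ℕ) :
    Received interarrival service l n (prepend g ((j, s), e)) ↔
      Received interarrival service l n e := by
  have := he.arrival_pos l n
  unfold Received
  rw [arrival_prepend_of_ne hl, service_prepend_of_ne hl, exists_arrival_prepend fun t =>
    g + arrival interarrival l n e < t ∧ t < g + arrival interarrival l n e + service l n e]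
  simp only [add_assoc, add_lt_add_iff_left]
  rw [or_iff_right]
  rintro ⟨h, -⟩
  linarith

lemma received_prepend_succ (he : PosInterarrival e) (n : ℕ) :
    Received interarrival service j (n + 1) (prepend g ((j, s), e)) ↔
      Received interarrival service j n e := by
  have := he.arrival_pos j n
  unfold Received
  rw [arrival_prepend_succ, service_prepend_succ, exists_arrival_prepend fun t =>
    g + arrival interarrival j n e < t ∧ t < g + arrival interarrival j n e + service j n e]
  simp only [add_assoc, add_lt_add_iff_left]
  rw [or_iff_right]
  rintro ⟨h, -⟩
  linarith

lemma received_prepend_zero (he : PosInterarrival e) :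
    Received interarrival service j 0 (prepend g ((j, s), e)) ↔ NoArrivalBefore s e := by
  unfold Received
  rw [arrival_prepend_zero, service_prepend_zero, exists_arrival_prepend fun t =>
    g < t ∧ t < g + s]
  simp only [lt_self_iff_false, false_and, false_or, add_lt_add_iff_left, lt_add_iff_pos_right,
    he.arrival_pos, true_and, not_exists, not_lt]
  rfl

lemma noArrivalBefore_prepend {t : ℝ} (he : PosInterarrival e) :
    NoArrivalBefore t (prepend g ((j, s), e)) ↔ t ≤ g := by
  have := exists_arrival_prepend (j := j) (g := g) (s := s) (e := e) fun r => r < t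
  rw [← not_iff_not]
  simp only [NoArrivalBefore, not_forall, not_le]
  rw [this, or_iff_left_iff_imp]
  rintro ⟨l, m, h⟩
  have := he.arrival_pos l m
  linarith

/-- Infinitude is needed because `Nat.nth` takes the default value `0` beyond the last solution,
which would break the shift by one. -/
lemma nth_of_tail {p : ℕ → Prop} [Decidable (p 0)] (h : {n | p (n + 1)}.Infinite) (k : ℕ) :
    Nat.nth p (k + if p 0 then 1 else 0) = Nat.nth (fun n => p (n + 1)) k + 1 := by
  classical
  set m := Nat.nth (fun n => p (n + 1)) k with hm
  have h1 : p (m + 1) := Nat.nth_mem_of_infinite h k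
  have h2 : Nat.count (fun n => p (n + 1)) m = k := Nat.count_nth_of_infinite h k
  conv_rhs => rw [← Nat.nth_count h1, Nat.count_succ', h2]
  congr

lemma receivedIndex_prepend_of_ne (he : PosInterarrival e) (hij : i ≠ j) (k : ℕ) :
    receivedIndex interarrival service i k (prepend g ((j, s), e)) =
      receivedIndex interarrival service i k e := by
  unfold receivedIndex
  congr 1
  ext n
  exact received_prepend_of_ne he hij n

lemma receivedIndex_prepend_self (he : PosInterarrival e) (hinf : InfReceived i e)
    (hs : ¬ NoArrivalBefore s e) (k : ℕ) :
    receivedIndex interarrival service i k (prepend g ((i, s), e)) =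
      receivedIndex interarrival service i k e + 1 := by
  classical
  have h := nth_of_tail (p := fun n => Received interarrival service i n (prepend g ((i, s), e)))
    (by simpa only [received_prepend_succ he, InfReceived] using hinf) k
  simpa only [received_prepend_succ he, received_prepend_zero he, hs, if_false, add_zero,
    receivedIndex] using h

lemma receivedIndex_prepend_zero (he : PosInterarrival e) (hs : NoArrivalBefore s e) :
    receivedIndex interarrival service i 0 (prepend g ((i, s), e)) = 0 :=
  Nat.nth_zero_of_zero ((received_prepend_zero he).2 hs)

lemma receivedIndex_prepend_succ (he : PosInterarrival e) (hinf : InfReceived i e)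
    (hs : NoArrivalBefore s e) (k : ℕ) :
    receivedIndex interarrival service i (k + 1) (prepend g ((i, s), e)) =
      receivedIndex interarrival service i k e + 1 := by
  classical
  have h := nth_of_tail (p := fun n => Received interarrival service i n (prepend g ((i, s), e)))
    (by simpa only [received_prepend_succ he, InfReceived] using hinf) k
  simpa only [received_prepend_succ he, received_prepend_zero he, hs, if_true,
    receivedIndex] using h

/-- If the first update is not a received update of source `i`, it does not matter for the moments
at which the received updates of source `i` arrive and depart. -/
lemma receivedArrival_departure_prepend (he : PosInterarrival e) (hinf : InfReceived i e)
    (hs : ¬ (j = i ∧ NoArrivalBefore s e)) (k : ℕ) :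
    receivedArrival interarrival service i k (prepend g ((j, s), e)) =
        g + receivedArrival interarrival service i k e ∧
      departure interarrival service i k (prepend g ((j, s), e)) =
        g + departure interarrival service i k e := by
  unfold departure receivedArrival
  by_cases hij : i = j
  · subst hij
    have hs' : ¬ NoArrivalBefore s e := fun h => hs ⟨rfl, h⟩
    rw [receivedIndex_prepend_self he hinf hs', arrival_prepend_succ, service_prepend_succ]
    exact ⟨rfl, by ring⟩
  · rw [receivedIndex_prepend_of_ne he hij, arrival_prepend_of_ne hij, service_prepend_of_ne hij]
    exact ⟨rfl, by ring⟩

lemma receivedArrival_departure_prepend_zero (he : PosInterarrival e)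
    (hs : NoArrivalBefore s e) :
    receivedArrival interarrival service i 0 (prepend g ((i, s), e)) = g ∧
      departure interarrival service i 0 (prepend g ((i, s), e)) = g + s := by
  unfold departure receivedArrival
  rw [receivedIndex_prepend_zero he hs, arrival_prepend_zero, service_prepend_zero]
  exact ⟨rfl, rfl⟩

lemma receivedArrival_departure_prepend_succ (he : PosInterarrival e) (hinf : InfReceived i e)
    (hs : NoArrivalBefore s e) (k : ℕ) :
    receivedArrival interarrival service i (k + 1) (prepend g ((i, s), e)) =
        g + receivedArrival interarrival service i k e ∧
      departure interarrival service i (k + 1) (prepend g ((i, s), e)) =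
        g + departure interarrival service i k e := by
  unfold departure receivedArrival
  rw [receivedIndex_prepend_succ he hinf hs, arrival_prepend_succ, service_prepend_succ]
  exact ⟨rfl, by ring⟩

open Classical in
/-- The number of received updates among the first `n` updates of source `i`. -/
noncomputable def receivedCount (i : Fin N) (n : ℕ) (e : Input N) : ℕ :=
  Nat.count (fun n => Received interarrival service i n e) n

lemma count_congr {p q : ℕ → Prop} [DecidablePred p] [DecidablePred q] (h : ∀ n, p n ↔ q n)
    (n : ℕ) : Nat.count p n = Nat.count q n := by
  obtain rfl : p = q := funext fun n => propext (h n)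
  congr

open Classical in
lemma receivedCount_prepend_succ (he : PosInterarrival e) (n : ℕ) :
    receivedCount i (n + 1) (prepend g ((i, s), e)) =
      receivedCount i n e + if NoArrivalBefore s e then 1 else 0 := by
  unfold receivedCount
  rw [Nat.count_succ']
  congr 1
  · exact count_congr (fun n => received_prepend_succ he n) n
  · simp only [received_prepend_zero he]

lemma receivedCount_mono {m n : ℕ} (h : m ≤ n) : receivedCount i m e ≤ receivedCount i n e :=
  letI := Classical.decPred fun n => Received interarrival service i n e
  Nat.count_monotone _ h

/-- Unlike the moments defined through `Nat.nth`, counts behave well under prepending without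
infinitude, so they can be used to prove infinitude. -/
lemma forall_receivedCount_le_prepend (he : PosInterarrival e)
    (hs : ¬ (j = i ∧ NoArrivalBefore s e)) (k : ℕ) :
    (∀ n, receivedCount i n (prepend g ((j, s), e)) ≤ k) ↔ ∀ n, receivedCount i n e ≤ k := by
  classical
  by_cases hij : i = j
  · subst hij
    have hs' : ¬ NoArrivalBefore s e := fun h => hs ⟨rfl, h⟩
    constructor
    · intro h n
      simpa [receivedCount_prepend_succ he, hs'] using h (n + 1)
    · intro h n
      refine (receivedCount_mono n.le_succ).trans ?_
      simpa [receivedCount_prepend_succ he, hs'] using h n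
  · refine forall_congr' fun n => ?_
    simp only [receivedCount]
    rw [count_congr fun n => received_prepend_of_ne he hij n]

lemma forall_receivedCount_le_prepend_succ (he : PosInterarrival e)
    (hs : NoArrivalBefore s e) (k : ℕ) :
    (∀ n, receivedCount i n (prepend g ((i, s), e)) ≤ k + 1) ↔ ∀ n, receivedCount i n e ≤ k := by
  constructor
  · intro h n
    simpa [receivedCount_prepend_succ he, hs] using h (n + 1)
  · intro h n
    refine (receivedCount_mono n.le_succ).trans ?_
    simpa [receivedCount_prepend_succ he, hs] using h n

lemma not_forall_receivedCount_prepend_le_zero (he : PosInterarrival e)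
    (hs : NoArrivalBefore s e) : ¬ ∀ n, receivedCount i n (prepend g ((i, s), e)) ≤ 0 := by
  intro h
  simpa [receivedCount_prepend_succ he, hs] using h 1

lemma infReceived_of_receivedCount (h : ∀ k, ¬ ∀ n, receivedCount i n e ≤ k) :
    InfReceived i e := by
  classical
  intro hf
  exact h _ fun n => Nat.count_le_card hf n

end Pathwise

/-! ### Measurability -/

section Measurability

variable {N : ℕ}

@[fun_prop]
lemma measurable_service (l : Fin N) (m : ℕ) : Measurable (service l m) := by
  unfold service; fun_prop

@[fun_prop]
lemma measurable_arrival (l : Fin N) (m : ℕ) : Measurable (arrival interarrival l m) := by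
  unfold arrival interarrival; fun_prop

lemma measurableSet_noArrivalBefore :
    MeasurableSet {p : ℝ × Input N | NoArrivalBefore p.1 p.2} := by
  simp only [NoArrivalBefore, Set.ofPred_forall]
  exact .iInter fun l => .iInter fun m =>
    measurableSet_le measurable_fst ((measurable_arrival l m).comp measurable_snd)

lemma measurableSet_received (l : Fin N) (n : ℕ) :
    MeasurableSet {e : Input N | Received interarrival service l n e} := by
  simp only [Received, not_exists, Set.ofPred_forall]
  refine .iInter fun l => .iInter fun m => MeasurableSet.compl (MeasurableSet.inter ?_ ?_)
  · exact measurableSet_lt (measurable_arrival _ _) (measurable_arrival _ _)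
  · exact measurableSet_lt (measurable_arrival _ _)
      ((measurable_arrival _ _).add (measurable_service _ _))

lemma measurable_receivedCount (i : Fin N) (n : ℕ) : Measurable (receivedCount i n) := by
  classical
  induction n with
  | zero =>
    have : receivedCount i 0 = fun _ => 0 := by funext e; simp [receivedCount]
    rw [this]; exact measurable_const
  | succ n ih =>
    have : receivedCount i (n + 1) = fun e => receivedCount i n e +
        if Received interarrival service i n e then 1 else 0 := by
      funext e
      simp only [receivedCount, Nat.count_succ]
    rw [this]
    exact ih.add (Measurable.ite (measurableSet_received i n) measurable_const measurable_const)

lemma measurable_receivedIndex (i : Fin N) (k : ℕ) :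
    Measurable (receivedIndex interarrival service i k) := by
  classical
  -- A nonzero value of `Nat.nth` is never the default one, so it is characterized by reception and
  -- count. The fibre over `0`, which includes the default case, is obtained as a complement.
  have key : ∀ n ≠ 0, receivedIndex interarrival service i k ⁻¹' {n} =
      {e | Received interarrival service i n e} ∩ receivedCount i n ⁻¹' {k} := by
    intro n hn
    ext e
    simp only [Set.mem_preimage, Set.mem_singleton_iff, Set.mem_inter_iff, Set.mem_ofPred_eq,
      receivedIndex, receivedCount]
    constructor
    · rintro rfl
      exact ⟨Nat.nth_mem _ (Nat.lt_card_toFinset_of_nth_ne_zero hn),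
        Nat.count_nth (Nat.lt_card_toFinset_of_nth_ne_zero hn)⟩
    · rintro ⟨h1, rfl⟩
      exact Nat.nth_count (p := fun n => Received interarrival service i n e) h1
  have meas : ∀ n ≠ 0, MeasurableSet (receivedIndex interarrival service i k ⁻¹' {n}) := by
    intro n hn
    rw [key n hn]
    exact (measurableSet_received i n).inter (measurable_receivedCount i n (.singleton k))
  refine measurable_to_countable' fun n => ?_
  by_cases hn : n = 0
  · have : receivedIndex interarrival service i k ⁻¹' {n} =
        (⋃ m : ℕ, receivedIndex interarrival service i k ⁻¹' {m + 1})ᶜ := by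
      ext e
      simp only [hn, Set.mem_preimage, Set.mem_singleton_iff, Set.mem_compl_iff, Set.mem_iUnion,
        not_exists]
      exact ⟨fun h m => by omega, fun h => by
        by_contra h0
        exact h _ (Nat.succ_pred_eq_of_ne_zero h0).symm⟩
    rw [this]
    exact (MeasurableSet.iUnion fun m => meas _ m.succ_ne_zero).compl
  · exact meas n hn

lemma measurable_receivedArrival (i : Fin N) (k : ℕ) :
    Measurable (receivedArrival interarrival service i k) :=
  (measurable_from_prod_countable_right (f := fun p : ℕ × Input N => arrival interarrival i p.1 p.2)
    fun n => measurable_arrival i n).comp ((measurable_receivedIndex i k).prodMk measurable_id)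

lemma measurable_departure (i : Fin N) (k : ℕ) :
    Measurable (departure interarrival service i k) :=
  (measurable_receivedArrival i k).add
    ((measurable_from_prod_countable_right (f := fun p : ℕ × Input N => service i p.1 p.2)
    fun n => measurable_service i n).comp ((measurable_receivedIndex i k).prodMk measurable_id))

end Measurability

/-! ### The renewal argument -/

section Renewal

variable {N : ℕ} {rate : Fin N → ℝ} {ν : Measure ℝ} {α : Fin N → Measure Updates}

/-- The law of the source and the service time of the first update and of the input that
follows. -/
noncomputable def stateLaw (rate : Fin N → ℝ) (ν : Measure ℝ) (α : Fin N → Measure Updates) :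
    Measure ((Fin N × ℝ) × Input N) :=
  ((sourceLaw rate).prod ν).prod (Measure.pi α)

/-- The probability that no update arrives during a service time. -/
noncomputable def uninterruptedProb (rate : Fin N → ℝ) (ν : Measure ℝ) : ℝ≥0∞ :=
  ∫⁻ s, expMeasure (∑ l, rate l) (Set.Ici s) ∂ν

lemma IsUpdatesLaw.isProbabilityMeasure_firstArrival (h : IsUpdatesLaw rate ν α) (i : Fin N) :
    IsProbabilityMeasure (expMeasure (∑ l, rate l)) :=
  ProbabilityTheory.isProbabilityMeasure_expMeasure (h.sum_pos i)

lemma IsUpdatesLaw.ae_snd_stateLaw (h : IsUpdatesLaw rate ν α) (i : Fin N) {p : Input N → Prop}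
    (hp : ∀ᵐ e ∂Measure.pi α, p e) : ∀ᵐ w ∂stateLaw rate ν α, p w.2 := by
  have := h.isProbabilityMeasure_sourceLaw i
  exact Measure.quasiMeasurePreserving_snd.ae hp

lemma IsUpdatesLaw.sourceLaw_singleton_pos (h : IsUpdatesLaw rate ν α) (i : Fin N) :
    sourceLaw rate {i} ≠ 0 := by
  have h1 := lintegral_sourceLaw rate (Set.indicator {i} 1)
  rw [lintegral_indicator_one (.singleton i)] at h1
  rw [h1]
  refine (lt_of_lt_of_le ?_ (Finset.single_le_sum (fun _ _ => zero_le) (Finset.mem_univ i))).ne'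
  simpa using div_pos (h.rate_pos i) (h.sum_pos i)

lemma IsUpdatesLaw.uninterruptedProb_eq (h : IsUpdatesLaw rate ν α) (i : Fin N)
    (hν : ∀ᵐ s ∂ν, 0 ≤ s) : uninterruptedProb rate ν =
      ∫⁻ s, ENNReal.ofReal (Real.exp (-((∑ l, rate l) * s))) ∂ν := by
  refine lintegral_congr_ae ?_
  filter_upwards [hν] with s hs using expMeasure_Ici (h.sum_pos i) hs

/-- Let `D` be an event that is not affected by the first update unless this is a received update
of source `i`, in which case the occurrence of `D` is described by `Q` in terms of the service time
of the first update and the input that follows. -/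
structure IsRenewal (i : Fin N) (μ : Measure (Input N)) (D : Set (Input N))
    (Q : Set (ℝ × Input N)) : Prop where
  measurableSet_event : MeasurableSet D
  measurableSet_renewed : MeasurableSet Q
  not_received : ∀ᵐ e ∂μ, ∀ g j s, ¬ (j = i ∧ NoArrivalBefore s e) →
    (prepend g ((j, s), e) ∈ D ↔ e ∈ D)
  received : ∀ᵐ e ∂μ, ∀ g s, NoArrivalBefore s e → (prepend g ((i, s), e) ∈ D ↔ (s, e) ∈ Q)

/-- Neither description of `D` after prepending mentions `g`, so `D` ignores the first arrival time.
-/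
lemma IsRenewal.invariant (h : IsUpdatesLaw rate ν α) {i : Fin N} {D : Set (Input N)}
    {Q : Set (ℝ × Input N)} (hD : IsRenewal i (Measure.pi α) D Q) :
    ∀ᵐ w ∂stateLaw rate ν α, ∀ g, prepend g w ∈ D ↔ prepend 0 w ∈ D := by
  filter_upwards [h.ae_snd_stateLaw i hD.not_received, h.ae_snd_stateLaw i hD.received]
    with ⟨⟨j, s⟩, e⟩ h1 h2 g
  by_cases hR : j = i ∧ NoArrivalBefore s e
  · obtain ⟨rfl, hR⟩ := hR
    rw [h2 g s hR, h2 0 s hR]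
  · rw [h1 g j s hR, h1 0 j s hR]

variable [IsProbabilityMeasure ν]

lemma IsUpdatesLaw.uninterruptedProb_ne_zero (h : IsUpdatesLaw rate ν α) (i : Fin N)
    (hν : ∀ᵐ s ∂ν, 0 ≤ s) : uninterruptedProb rate ν ≠ 0 := by
  rw [h.uninterruptedProb_eq i hν, ne_eq, lintegral_eq_zero_iff (by fun_prop)]
  intro h0
  obtain ⟨s, hs⟩ := h0.exists
  simp only [Pi.zero_apply, ENNReal.ofReal_eq_zero, not_le.2 (Real.exp_pos _)] at hs

lemma IsUpdatesLaw.uninterruptedProb_ne_top (h : IsUpdatesLaw rate ν α) (i : Fin N) :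
    uninterruptedProb rate ν ≠ ∞ := by
  have := h.isProbabilityMeasure_firstArrival i
  refine ne_top_of_le_ne_top ENNReal.one_ne_top ?_
  calc uninterruptedProb rate ν ≤ ∫⁻ _, 1 ∂ν := lintegral_mono fun s => prob_le_one
    _ = 1 := by simp

variable [∀ j, IsProbabilityMeasure (α j)]

lemma IsUpdatesLaw.ae_posInterarrival (h : IsUpdatesLaw rate ν α) :
    ∀ᵐ e ∂Measure.pi α, PosInterarrival e := by
  refine ae_all_iff.2 fun j => ?_
  exact (measurePreserving_eval α j).quasiMeasurePreserving.ae (h.ae_pos j)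

lemma IsUpdatesLaw.isProbabilityMeasure_stateLaw (h : IsUpdatesLaw rate ν α) (i : Fin N) :
    IsProbabilityMeasure (stateLaw rate ν α) := by
  have := h.isProbabilityMeasure_sourceLaw i
  unfold stateLaw
  infer_instance

lemma IsUpdatesLaw.pi_apply (h : IsUpdatesLaw rate ν α) (i : Fin N) {D : Set (Input N)}
    (hD : MeasurableSet D) :
    Measure.pi α D =
      ((expMeasure (∑ l, rate l)).prod (stateLaw rate ν α)) {p | prepend p.1 p.2 ∈ D} := by
  conv_lhs => rw [← h.map_prepend i]
  exact Measure.map_apply measurable_prepend hD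

lemma IsUpdatesLaw.stateLaw_of_source (h : IsUpdatesLaw rate ν α) (i : Fin N)
    {K : Set (ℝ × Input N)} (hK : MeasurableSet K) :
    stateLaw rate ν α {w | w.1.1 = i ∧ (w.1.2, w.2) ∈ K} =
      sourceLaw rate {i} * (ν.prod (Measure.pi α)) K := by
  have := h.isProbabilityMeasure_sourceLaw i
  have h1 : {w : (Fin N × ℝ) × Input N | w.1.1 = i ∧ (w.1.2, w.2) ∈ K} =
      MeasurableEquiv.prodAssoc ⁻¹' ({i} ×ˢ K) := by
    ext w; rfl
  rw [h1, ← Measure.prod_prod, stateLaw, ← Measure.prodAssoc_prod,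
    Measure.map_apply (MeasurableEquiv.measurable _) ((MeasurableSet.singleton i).prod hK)]

/-- An event that does not depend on the first arrival time is independent of it, since that time is
independent of the rest. -/
lemma IsUpdatesLaw.prod_firstArrival (h : IsUpdatesLaw rate ν α) (i : Fin N)
    {D : Set (Input N)} (hD : MeasurableSet D)
    (hinv : ∀ᵐ w ∂stateLaw rate ν α, ∀ g, prepend g w ∈ D ↔ prepend 0 w ∈ D) (A : Set ℝ) :
    ((expMeasure (∑ l, rate l)).prod (stateLaw rate ν α)) {p | p.1 ∈ A ∧ prepend p.1 p.2 ∈ D} =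
      expMeasure (∑ l, rate l) A * Measure.pi α D := by
  have := h.isProbabilityMeasure_firstArrival i
  have := h.isProbabilityMeasure_stateLaw i
  have key : ∀ A : Set ℝ, ((expMeasure (∑ l, rate l)).prod (stateLaw rate ν α))
      {p | p.1 ∈ A ∧ prepend p.1 p.2 ∈ D} =
      expMeasure (∑ l, rate l) A * stateLaw rate ν α {w | prepend 0 w ∈ D} := by
    intro A
    rw [← Measure.prod_prod]
    refine measure_congr ?_
    filter_upwards [Measure.quasiMeasurePreserving_snd.ae hinv] with p hp
    exact propext (and_congr_right fun _ => hp p.1)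
  rw [key, h.pi_apply i hD]
  congr 1
  -- Taking `A = univ` identifies the second factor with the probability of `D`.
  have := key Set.univ
  simpa using this.symm

lemma IsUpdatesLaw.pi_noArrivalBefore (h : IsUpdatesLaw rate ν α) (i : Fin N) (s : ℝ)
    {D : Set (Input N)} (hD : MeasurableSet D) :
    Measure.pi α {e | NoArrivalBefore s e ∧ e ∈ D} =
      ((expMeasure (∑ l, rate l)).prod (stateLaw rate ν α))
        {p | p.1 ∈ Set.Ici s ∧ prepend p.1 p.2 ∈ D} := by
  have := h.isProbabilityMeasure_firstArrival i
  have := h.isProbabilityMeasure_stateLaw i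
  have m : MeasurableSet {e : Input N | NoArrivalBefore s e ∧ e ∈ D} :=
    ((by fun_prop : Measurable fun e : Input N => (s, e)) measurableSet_noArrivalBefore).inter hD
  rw [h.pi_apply i m]
  refine measure_congr ?_
  filter_upwards [Measure.quasiMeasurePreserving_snd.ae
    (h.ae_snd_stateLaw i h.ae_posInterarrival)] with p hp
  exact propext (and_congr_left fun _ => noArrivalBefore_prepend hp)

/-- The absence of arrivals before `s` means that the first arrival time is at least `s`, which is
independent of `D` for each fixed `s`. -/
lemma IsUpdatesLaw.prod_noArrivalBefore (h : IsUpdatesLaw rate ν α) (i : Fin N)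
    {D : Set (Input N)} (hD : MeasurableSet D)
    (hinv : ∀ᵐ w ∂stateLaw rate ν α, ∀ g, prepend g w ∈ D ↔ prepend 0 w ∈ D) :
    (ν.prod (Measure.pi α)) {p | NoArrivalBefore p.1 p.2 ∧ p.2 ∈ D} =
      uninterruptedProb rate ν * Measure.pi α D := by
  have m : MeasurableSet {p : ℝ × Input N | NoArrivalBefore p.1 p.2 ∧ p.2 ∈ D} :=
    measurableSet_noArrivalBefore.inter (measurable_snd hD)
  rw [Measure.prod_apply m, uninterruptedProb, ← lintegral_mul_const' _ _ (measure_ne_top _ _)]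
  refine lintegral_congr fun s => ?_
  rw [← h.prod_firstArrival i hD hinv, ← h.pi_noArrivalBefore i s hD]
  rfl

/-- The renewal identity. The prepended input and its tail are equal in law, so `D` is equally
likely for both. Off the event `R` that the first update is a received one of source `i` they agree
about `D`; hence `D` is equally likely for both on `R` too. -/
theorem IsRenewal.measure_eq (h : IsUpdatesLaw rate ν α) {i : Fin N} {D : Set (Input N)}
    {Q : Set (ℝ × Input N)} (hD : IsRenewal i (Measure.pi α) D Q) :
    uninterruptedProb rate ν * Measure.pi α D =
      (ν.prod (Measure.pi α)) {p | NoArrivalBefore p.1 p.2 ∧ p ∈ Q} := by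
  have i1 := h.isProbabilityMeasure_sourceLaw i
  have i2 := h.isProbabilityMeasure_firstArrival i
  have i3 := h.isProbabilityMeasure_stateLaw i
  rw [← h.prod_noArrivalBefore i hD.measurableSet_event (hD.invariant h)]
  have mR : MeasurableSet {w : (Fin N × ℝ) × Input N |
      w.1.1 = i ∧ (w.1.2, w.2) ∈ {p : ℝ × Input N | NoArrivalBefore p.1 p.2}} :=
    (measurableSet_eq_fun (by fun_prop) measurable_const).inter
      ((by fun_prop : Measurable fun w : (Fin N × ℝ) × Input N => (w.1.2, w.2))
        measurableSet_noArrivalBefore)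
  set Z := (expMeasure (∑ l, rate l)).prod (stateLaw rate ν α) with hZ
  set R : Set (ℝ × (Fin N × ℝ) × Input N) := {p | p.2.1.1 = i ∧ NoArrivalBefore p.2.1.2 p.2.2}
    with hR
  have mR' : MeasurableSet R := measurable_snd mR
  have snd : ∀ B : Set ((Fin N × ℝ) × Input N), Z (Prod.snd ⁻¹' B) = stateLaw rate ν α B := by
    intro B
    rw [hZ, ← Set.univ_prod, Measure.prod_prod, measure_univ, one_mul]
  have hlaw : Z {p | prepend p.1 p.2 ∈ D} = Z {p | p.2.2 ∈ D} := by
    rw [← h.pi_apply i hD.measurableSet_event]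
    have : {p : ℝ × (Fin N × ℝ) × Input N | p.2.2 ∈ D} = Prod.snd ⁻¹' (Set.univ ×ˢ D) := by
      ext p; simp
    rw [this, snd, stateLaw, Measure.prod_prod, measure_univ, one_mul]
  have hn : Z ({p | prepend p.1 p.2 ∈ D} \ R) = Z ({p | p.2.2 ∈ D} \ R) := by
    refine measure_congr ?_
    filter_upwards [Measure.quasiMeasurePreserving_snd.ae (h.ae_snd_stateLaw i hD.not_received)]
      with p hp
    exact propext (and_congr_left fun hpR => hp p.1 p.2.1.1 p.2.1.2 hpR)
  have hy : Z ({p | prepend p.1 p.2 ∈ D} ∩ R) = Z (Prod.snd ⁻¹' {w | w.1.1 = i ∧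
      (w.1.2, w.2) ∈ {p | NoArrivalBefore p.1 p.2 ∧ p ∈ Q}}) := by
    refine measure_congr ?_
    filter_upwards [Measure.quasiMeasurePreserving_snd.ae (h.ae_snd_stateLaw i hD.received)]
      with p hp
    refine propext ⟨?_, ?_⟩
    · rintro ⟨h1, h2, h3⟩
      refine ⟨h2, h3, (hp p.1 p.2.1.2 h3).1 ?_⟩
      rw [← h2]
      exact h1
    · rintro ⟨h2, h3, h1⟩
      refine ⟨?_, h2, h3⟩
      have := (hp p.1 p.2.1.2 h3).2 h1
      rw [← h2] at this
      exact this
  have hy' : Z ({p | p.2.2 ∈ D} ∩ R) = Z (Prod.snd ⁻¹' {w | w.1.1 = i ∧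
      (w.1.2, w.2) ∈ {p | NoArrivalBefore p.1 p.2 ∧ p.2 ∈ D}}) := by
    congr 1
    ext p
    exact ⟨fun ⟨h1, h2, h3⟩ => ⟨h2, h3, h1⟩, fun ⟨h2, h3, h1⟩ => ⟨h1, h2, h3⟩⟩
  have mQ : MeasurableSet {p : ℝ × Input N | NoArrivalBefore p.1 p.2 ∧ p ∈ Q} :=
    measurableSet_noArrivalBefore.inter hD.measurableSet_renewed
  have mD : MeasurableSet {p : ℝ × Input N | NoArrivalBefore p.1 p.2 ∧ p.2 ∈ D} :=
    measurableSet_noArrivalBefore.inter (measurable_snd hD.measurableSet_event)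
  have e1 := measure_inter_add_sdiff (μ := Z) {p | prepend p.1 p.2 ∈ D} mR'
  have e2 := measure_inter_add_sdiff (μ := Z) {p | p.2.2 ∈ D} mR'
  -- Cancel the finite common part off `R`, then the positive probability of source `i`.
  rw [hlaw, ← e2, hn, ENNReal.add_left_inj (measure_ne_top _ _), hy, hy', snd, snd,
    h.stateLaw_of_source i mQ, h.stateLaw_of_source i mD,
    ENNReal.mul_right_inj (h.sourceLaw_singleton_pos i) (measure_ne_top _ _)] at e1
  exact e1.symm

/-- An event that does not change at a renewal but is replaced by another one with the same
property has the same probability as that other event. -/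
lemma IsRenewal.measure_eq_of_renewal (h : IsUpdatesLaw rate ν α) {i : Fin N}
    {D D' : Set (Input N)} {Q : Set (ℝ × Input N)}
    (hc : uninterruptedProb rate ν ≠ 0) (hc' : uninterruptedProb rate ν ≠ ∞)
    (hD : IsRenewal i (Measure.pi α) D {p | p.2 ∈ D'})
    (hD' : IsRenewal i (Measure.pi α) D' Q) :
    Measure.pi α D = Measure.pi α D' := by
  have h1 := hD.measure_eq h
  rw [← ENNReal.mul_right_inj hc hc', h1]
  exact h.prod_noArrivalBefore i hD'.measurableSet_event (hD'.invariant h)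

/-- Almost surely infinitely many updates of source `i` are received. -/
theorem IsUpdatesLaw.ae_infReceived (h : IsUpdatesLaw rate ν α) (i : Fin N)
    (hν : ∀ᵐ s ∂ν, 0 ≤ s) : ∀ᵐ e ∂Measure.pi α, InfReceived i e := by
  have m : ∀ k, MeasurableSet {e : Input N | ∀ n, receivedCount i n e ≤ k} := fun k => by
    rw [Set.ofPred_forall]
    exact .iInter fun n => measurableSet_le (measurable_receivedCount i n) measurable_const
  have h0 : IsRenewal i (Measure.pi α) {e : Input N | ∀ n, receivedCount i n e ≤ 0} ∅ := by
    refine ⟨m 0, .empty, ?_, ?_⟩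
    · filter_upwards [h.ae_posInterarrival] with e he g j s hs
      exact forall_receivedCount_le_prepend he hs 0
    · filter_upwards [h.ae_posInterarrival] with e he g s hs
      exact iff_of_false (not_forall_receivedCount_prepend_le_zero he hs) (Set.notMem_empty _)
  have hsucc : ∀ k, IsRenewal i (Measure.pi α) {e : Input N | ∀ n, receivedCount i n e ≤ k + 1}
      {p | p.2 ∈ {e : Input N | ∀ n, receivedCount i n e ≤ k}} := by
    refine fun k => ⟨m (k + 1), measurable_snd (m k), ?_, ?_⟩
    · filter_upwards [h.ae_posInterarrival] with e he g j s hs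
      exact forall_receivedCount_le_prepend he hs (k + 1)
    · filter_upwards [h.ae_posInterarrival] with e he g s hs
      exact forall_receivedCount_le_prepend_succ he hs k
  have hc := h.uninterruptedProb_ne_zero i hν
  have hc' := h.uninterruptedProb_ne_top i
  have null : ∀ k, Measure.pi α {e : Input N | ∀ n, receivedCount i n e ≤ k} = 0 := by
    intro k
    induction k with
    -- Here `Q` is empty, so the identity reads `c · P(D) = 0` with `c ≠ 0`.
    | zero => simpa [hc] using h0.measure_eq h
    | succ k ih =>
      cases k with
      | zero => exact ((hsucc 0).measure_eq_of_renewal h hc hc' h0).trans ih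
      | succ k => exact ((hsucc (k + 1)).measure_eq_of_renewal h hc hc' (hsucc k)).trans ih
  have : ∀ᵐ e ∂Measure.pi α, ∀ k, ¬ ∀ n, receivedCount i n e ≤ k :=
    ae_all_iff.2 fun k => by rw [ae_iff]; simpa only [not_not] using null k
  filter_upwards [this] with e he using infReceived_of_receivedCount he

end Renewal

/-! ### The joint law of the system time and the inter-departure time -/

section JointLaw

variable {N : ℕ} {rate : Fin N → ℝ} {ν : Measure ℝ} {α : Fin N → Measure Updates}

/-- The law of the service time of an uninterrupted update. -/
noncomputable def systemLaw (rate : Fin N → ℝ) (ν : Measure ℝ) : Measure ℝ :=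
  (uninterruptedProb rate ν)⁻¹ •
    ν.withDensity fun s => ENNReal.ofReal (Real.exp (-((∑ l, rate l) * s)))

lemma measurable_systemTime (i : Fin N) (k : ℕ) :
    Measurable (systemTime interarrival service i k) :=
  (measurable_departure i k).sub (measurable_receivedArrival i k)

lemma measurable_interDeparture (i : Fin N) (k : ℕ) :
    Measurable (interDeparture interarrival service i k) :=
  (measurable_departure i (k + 1)).sub (measurable_departure i k)

lemma IsUpdatesLaw.isProbabilityMeasure_systemLaw [IsProbabilityMeasure ν]
    (h : IsUpdatesLaw rate ν α) (i : Fin N) (hν : ∀ᵐ s ∂ν, 0 ≤ s) :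
    IsProbabilityMeasure (systemLaw rate ν) := by
  constructor
  rw [systemLaw, Measure.smul_apply, withDensity_apply _ .univ, Measure.restrict_univ,
    ← h.uninterruptedProb_eq i hν, smul_eq_mul, ENNReal.inv_mul_cancel
      (h.uninterruptedProb_ne_zero i hν) (h.uninterruptedProb_ne_top i)]

variable [IsProbabilityMeasure ν] [∀ j, IsProbabilityMeasure (α j)]

/-- System and inter-departure times are differences of moments, so the common shift `g` cancels; a
received first update of source `i` only raises the index by one. -/
lemma isRenewal_succ (h : IsUpdatesLaw rate ν α) (i : Fin N) (hν : ∀ᵐ s ∂ν, 0 ≤ s) (k : ℕ)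
    {M : Set (ℝ × ℝ)} (hM : MeasurableSet M) :
    IsRenewal i (Measure.pi α) {e | (systemTime interarrival service i (k + 1) e,
      interDeparture interarrival service i (k + 1) e) ∈ M}
      {p | p.2 ∈ {e | (systemTime interarrival service i k e,
        interDeparture interarrival service i k e) ∈ M}} := by
  have m := fun k => ((measurable_systemTime i k).prodMk (measurable_interDeparture i k)) hM
  refine ⟨m (k + 1), measurable_snd (m k), ?_, ?_⟩
  · filter_upwards [h.ae_posInterarrival, h.ae_infReceived i hν] with e he hinf g j s hs
    have := fun k => receivedArrival_departure_prepend (g := g) he hinf hs k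
    simp only [systemTime, interDeparture, this, add_sub_add_left_eq_sub]
  · filter_upwards [h.ae_posInterarrival, h.ae_infReceived i hν] with e he hinf g s hs
    have := fun k => receivedArrival_departure_prepend_succ (g := g) he hinf hs k
    simp only [systemTime, interDeparture, this, add_sub_add_left_eq_sub]

/-- A received first update of source `i` departs at `g + s` and the next one at `g` plus the first
departure time of the tail. -/
lemma isRenewal_zero (h : IsUpdatesLaw rate ν α) (i : Fin N) (hν : ∀ᵐ s ∂ν, 0 ≤ s)
    {M : Set (ℝ × ℝ)} (hM : MeasurableSet M) :
    IsRenewal i (Measure.pi α) {e | (systemTime interarrival service i 0 e,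
      interDeparture interarrival service i 0 e) ∈ M}
      {p | (p.1, departure interarrival service i 0 p.2 - p.1) ∈ M} := by
  refine ⟨((measurable_systemTime i 0).prodMk (measurable_interDeparture i 0)) hM,
    (measurable_fst.prodMk (((measurable_departure i 0).comp measurable_snd).sub measurable_fst))
      hM, ?_, ?_⟩
  · filter_upwards [h.ae_posInterarrival, h.ae_infReceived i hν] with e he hinf g j s hs
    have := fun k => receivedArrival_departure_prepend (g := g) he hinf hs k
    simp only [systemTime, interDeparture, this, add_sub_add_left_eq_sub]
  · filter_upwards [h.ae_posInterarrival, h.ae_infReceived i hν] with e he hinf g s hs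
    have h0 := receivedArrival_departure_prepend_zero (i := i) (g := g) he hs
    have h1 := receivedArrival_departure_prepend_succ (g := g) he hinf hs 0
    simp only [systemTime, interDeparture, h0, h1, add_sub_add_left_eq_sub,
      add_sub_cancel_left]

lemma ae_departure_prepend (h : IsUpdatesLaw rate ν α) (i : Fin N) (hν : ∀ᵐ s ∂ν, 0 ≤ s) :
    ∀ᵐ w ∂stateLaw rate ν α, ∀ g, departure interarrival service i 0 (prepend g w) =
      g + departure interarrival service i 0 (prepend 0 w) := by
  filter_upwards [h.ae_snd_stateLaw i h.ae_posInterarrival,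
    h.ae_snd_stateLaw i (h.ae_infReceived i hν)] with ⟨⟨j, s⟩, e⟩ he hinf g
  by_cases hR : j = i ∧ NoArrivalBefore s e
  · obtain ⟨rfl, hR⟩ := hR
    rw [(receivedArrival_departure_prepend_zero he hR).2,
      (receivedArrival_departure_prepend_zero he hR).2]
    ring
  · rw [(receivedArrival_departure_prepend he hinf hR 0).2,
      (receivedArrival_departure_prepend he hinf hR 0).2]
    ring

lemma prod_departure_prepend (h : IsUpdatesLaw rate ν α) (i : Fin N) (hν : ∀ᵐ s ∂ν, 0 ≤ s)
    {A B : Set ℝ} (hA : MeasurableSet A) (hB : MeasurableSet B) :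
    ((expMeasure (∑ l, rate l)).prod (stateLaw rate ν α))
      {p | p.1 ∈ A ∧ departure interarrival service i 0 (prepend p.1 p.2) ∈ B} =
    ∫⁻ w, expMeasure (∑ l, rate l)
      ({g | g + departure interarrival service i 0 (prepend 0 w) ∈ B} ∩ A) ∂stateLaw rate ν α := by
  have i2 := h.isProbabilityMeasure_firstArrival i
  have i3 := h.isProbabilityMeasure_stateLaw i
  have m : MeasurableSet {p : ℝ × (Fin N × ℝ) × Input N |
      p.1 ∈ A ∧ departure interarrival service i 0 (prepend p.1 p.2) ∈ B} :=
    (measurable_fst hA).inter (((measurable_departure i 0).comp measurable_prepend) hB)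
  rw [Measure.prod_apply_symm m]
  refine lintegral_congr_ae ?_
  filter_upwards [ae_departure_prepend h i hν] with w hw
  congr 1
  ext g
  simp only [Set.mem_preimage, Set.mem_ofPred_eq, Set.mem_inter_iff, hw g, and_comm]

lemma pi_departure (h : IsUpdatesLaw rate ν α) (i : Fin N) (hν : ∀ᵐ s ∂ν, 0 ≤ s)
    {B : Set ℝ} (hB : MeasurableSet B) :
    Measure.pi α {e | departure interarrival service i 0 e ∈ B} =
    ∫⁻ w, expMeasure (∑ l, rate l)
      {g | g + departure interarrival service i 0 (prepend 0 w) ∈ B} ∂stateLaw rate ν α := by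
  have := prod_departure_prepend h i hν MeasurableSet.univ hB
  simp only [Set.mem_univ, true_and, Set.inter_univ] at this
  rw [← this]
  exact h.pi_apply i ((measurable_departure i 0) hB)

/-- The first departure time is `g` plus a quantity independent of `g`; given `g ≥ s`, the excess `g
- s` is again `Exp(λ)`. This is the source of the independence of system time and inter-departure
time. -/
lemma pi_departure_after (h : IsUpdatesLaw rate ν α) (i : Fin N) (hν : ∀ᵐ s ∂ν, 0 ≤ s)
    {s : ℝ} (hs : 0 ≤ s) {B : Set ℝ} (hB : MeasurableSet B) :
    Measure.pi α {e | NoArrivalBefore s e ∧ departure interarrival service i 0 e - s ∈ B} =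
      ENNReal.ofReal (Real.exp (-((∑ l, rate l) * s))) *
        Measure.pi α {e | departure interarrival service i 0 e ∈ B} := by
  have hB' : MeasurableSet {x : ℝ | x - s ∈ B} := (by fun_prop : Measurable fun x => x - s) hB
  have h1 := h.pi_noArrivalBefore i s ((measurable_departure i 0) hB')
  have h2 := prod_departure_prepend h i hν (measurableSet_Ici (a := s)) hB'
  have h3 := h1.trans h2
  rw [pi_departure h i hν hB, ← lintegral_const_mul' _ _ ENNReal.ofReal_ne_top]
  refine h3.trans (lintegral_congr fun w => ?_)
  have hB'' : MeasurableSet {g : ℝ |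
      g + departure interarrival service i 0 (prepend 0 w) ∈ {x : ℝ | x - s ∈ B}} :=
    (by fun_prop : Measurable fun g : ℝ => g + departure interarrival service i 0 (prepend 0 w)) hB'
  rw [← expMeasure_memoryless hs hB'']
  congr 3
  ext g
  simp only [Set.mem_ofPred_eq]
  ring_nf

/-- The law is a mixture of translates of an exponential law. -/
lemma absolutelyContinuous_map_departure (h : IsUpdatesLaw rate ν α) (i : Fin N)
    (hν : ∀ᵐ s ∂ν, 0 ≤ s) :
    (Measure.pi α).map (departure interarrival service i 0) ≪ volume := by
  refine Measure.AbsolutelyContinuous.mk fun B hB h0 => ?_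
  rw [Measure.map_apply (measurable_departure i 0) hB]
  refine (pi_departure h i hν hB).trans (lintegral_eq_zero_of_ae_eq_zero ?_)
  refine Filter.Eventually.of_forall fun w => expMeasure_absolutelyContinuous _ ?_
  exact (measure_preimage_add_right volume _ B).trans h0

/-- The system time of a received update and the time until the next departure of a received
update are independent, and the latter is distributed as the first departure time. -/
theorem map_systemTime_interDeparture (h : IsUpdatesLaw rate ν α) (i : Fin N)
    (hν : ∀ᵐ s ∂ν, 0 ≤ s) (k : ℕ) :
    (Measure.pi α).map (fun e => (systemTime interarrival service i k e,
      interDeparture interarrival service i k e)) =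
    (systemLaw rate ν).prod ((Measure.pi α).map (departure interarrival service i 0)) := by
  have hc := h.uninterruptedProb_ne_zero i hν
  have hc' := h.uninterruptedProb_ne_top i
  have i1 := h.isProbabilityMeasure_systemLaw i hν
  have i2 : IsProbabilityMeasure ((Measure.pi α).map (departure interarrival service i 0)) :=
    Measure.isProbabilityMeasure_map (measurable_departure i 0).aemeasurable
  have mk := fun k => (measurable_systemTime i k).prodMk (measurable_interDeparture i k)
  refine (Measure.prod_eq fun A B hA hB => ?_).symm
  have hM := hA.prod hB
  rw [Measure.map_apply (mk k) hM]
  have hk : ∀ k, Measure.pi α ((fun e => (systemTime interarrival service i k e,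
      interDeparture interarrival service i k e)) ⁻¹' A ×ˢ B) =
      Measure.pi α ((fun e => (systemTime interarrival service i 0 e,
      interDeparture interarrival service i 0 e)) ⁻¹' A ×ˢ B) := by
    intro k
    induction k with
    | zero => rfl
    | succ k ih =>
      rw [← ih]
      have h1 := isRenewal_succ h i hν k hM
      cases k with
      | zero => exact h1.measure_eq_of_renewal h hc hc' (isRenewal_zero h i hν hM)
      | succ k => exact h1.measure_eq_of_renewal h hc hc' (isRenewal_succ h i hν k hM)
  have h0 := isRenewal_zero h i hν hM
  have m : MeasurableSet {p : ℝ × Input N | NoArrivalBefore p.1 p.2 ∧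
      p ∈ {p | (p.1, departure interarrival service i 0 p.2 - p.1) ∈ A ×ˢ B}} :=
    measurableSet_noArrivalBefore.inter h0.measurableSet_renewed
  have h1 := h0.measure_eq h
  rw [Measure.prod_apply m] at h1
  -- For a fixed service time `s`, the condition `s ∈ A` is deterministic, and the remaining event
  -- has a probability of product form.
  have h2 : ∀ᵐ s ∂ν, Measure.pi α (Prod.mk s ⁻¹' {p : ℝ × Input N | NoArrivalBefore p.1 p.2 ∧
      p ∈ {p | (p.1, departure interarrival service i 0 p.2 - p.1) ∈ A ×ˢ B}}) =
      A.indicator (fun s => ENNReal.ofReal (Real.exp (-((∑ l, rate l) * s)))) s *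
        Measure.pi α {e | departure interarrival service i 0 e ∈ B} := by
    filter_upwards [hν] with s hs
    by_cases hsA : s ∈ A
    · rw [Set.indicator_of_mem hsA, ← pi_departure_after h i hν hs hB]
      congr 1
      ext e
      simp [hsA]
    · rw [Set.indicator_of_notMem hsA, zero_mul]
      convert measure_empty (μ := Measure.pi α)
      ext e
      simp [hsA]
  rw [lintegral_congr_ae h2, lintegral_mul_const' _ _ (measure_ne_top _ _),
    lintegral_indicator hA, ← withDensity_apply _ hA] at h1
  rw [hk, systemLaw, Measure.smul_apply, smul_eq_mul, mul_assoc,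
    Measure.map_apply (measurable_departure i 0) hB]
  refine (ENNReal.mul_right_inj hc hc').1 (h1.trans ?_)
  rw [← mul_assoc, ENNReal.mul_inv_cancel hc hc', one_mul]
  rfl

end JointLaw

/-! ### The sum of two independent nonnegative variables with densities -/

section Convolution

variable {f u : ℝ → ℝ}

/-- An arbitrary version of the density of a nonnegative variable vanishes on the negative half-line
only almost everywhere; hence the almost-everywhere hypotheses on `f` below. -/
lemma ae_eq_zero_of_densityLaw (hf : Measurable f) (hf0 : ∀ x, 0 ≤ f x)
    (h : ∀ᵐ x ∂densityLaw f, 0 ≤ x) : ∀ᵐ x : ℝ, x ≤ 0 → f x = 0 := by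
  rw [densityLaw, ae_withDensity_iff hf.ennreal_ofReal] at h
  filter_upwards [h, measure_eq_zero_iff_ae_notMem.1 (measure_singleton (0 : ℝ))] with x hx hx0 hle
  by_contra hne
  have h1 := hx (by simpa using lt_of_le_of_ne (hf0 x) (Ne.symm hne))
  exact hx0 (le_antisymm hle h1)

/-- The convolution of densities that vanish on the negative half-line. -/
lemma lconvolution_eq (hf : ∀ᵐ x : ℝ, x ≤ 0 → f x = 0) (hf0 : ∀ x, 0 ≤ f x)
    (hu : ∀ x < 0, u x = 0) (x : ℝ) :
    ((fun x => ENNReal.ofReal (f x)) ⋆ₗ fun x => ENNReal.ofReal (u x)) x =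
      ∫⁻ y in Set.Ioc 0 x, ENNReal.ofReal (f y * u (x - y)) := by
  rw [lconvolution_def, ← lintegral_indicator measurableSet_Ioc]
  refine lintegral_congr_ae ?_
  filter_upwards [hf] with y hy
  by_cases h0 : y ≤ 0
  · rw [hy h0, Set.indicator_of_notMem fun h => not_lt.2 h0 h.1]
    simp
  · by_cases hx : x < y
    · rw [Set.indicator_of_notMem fun h => not_lt.2 h.2 hx, hu _ (by linarith)]
      simp
    · rw [Set.indicator_of_mem (Set.mem_Ioc.2 ⟨not_le.1 h0, not_lt.1 hx⟩), ENNReal.ofReal_mul (hf0 y)]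
      ring_nf

/-- The convolution has total mass one, so it is finite almost everywhere; this is why the density
integral converges for almost every `x`. -/
lemma ae_lconvolution_lt_top (hf : Measurable f) (hu : Measurable u)
    [IsProbabilityMeasure (densityLaw f)] [IsProbabilityMeasure (densityLaw u)] :
    ∀ᵐ x : ℝ, ((fun x => ENNReal.ofReal (f x)) ⋆ₗ fun x => ENNReal.ofReal (u x)) x < ∞ := by
  refine ae_lt_top (measurable_lconvolution _ hf.ennreal_ofReal hu.ennreal_ofReal) ?_
  have h1 := conv_withDensity_eq_lconvolution (μ := (volume : Measure ℝ)) hf.ennreal_ofReal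
    hu.ennreal_ofReal
  have h2 : ((densityLaw f) ∗ (densityLaw u)) Set.univ = 1 := measure_univ
  rw [densityLaw, densityLaw, h1, withDensity_apply _ .univ, Measure.restrict_univ] at h2
  rw [h2]
  exact ENNReal.one_ne_top

lemma ae_integrableOn_convolution (hfm : Measurable f) (hum : Measurable u)
    (hf : ∀ᵐ x : ℝ, x ≤ 0 → f x = 0) (hf0 : ∀ x, 0 ≤ f x)
    (hu : ∀ x < 0, u x = 0) (hu0 : ∀ x, 0 ≤ u x)
    [IsProbabilityMeasure (densityLaw f)] [IsProbabilityMeasure (densityLaw u)] :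
    ∀ᵐ x : ℝ, IntegrableOn (fun y => f y * u (x - y)) (Set.Ioc 0 x) := by
  filter_upwards [ae_lconvolution_lt_top hfm hum] with x hx
  rw [lconvolution_eq hf hf0 hu] at hx
  have hm : Measurable fun y => f y * u (x - y) := by fun_prop
  refine ⟨hm.aestronglyMeasurable, ?_⟩
  rwa [hasFiniteIntegral_iff_ofReal
    (Filter.Eventually.of_forall fun y => mul_nonneg (hf0 y) (hu0 _))]

lemma measurable_convolution (hfm : Measurable f) (hum : Measurable u) :
    Measurable fun x : ℝ => if 0 ≤ x then ∫ y in (0 : ℝ)..x, f y * u (x - y) else 0 := by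
  have h1 : Measurable fun p : ℝ × ℝ =>
      (if 0 < p.2 ∧ p.2 ≤ p.1 then f p.2 * u (p.1 - p.2) else 0) := by
    refine Measurable.ite ?_ (by fun_prop) measurable_const
    exact (measurableSet_lt measurable_const measurable_snd).inter
      (measurableSet_le measurable_snd measurable_fst)
  have h2 : Measurable fun x : ℝ => ∫ y, (if 0 < y ∧ y ≤ x then f y * u (x - y) else 0) :=
    h1.stronglyMeasurable.integral_prod_right'.measurable
  have h3 : (fun x : ℝ => if 0 ≤ x then ∫ y in (0 : ℝ)..x, f y * u (x - y) else 0) = fun x =>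
      if 0 ≤ x then ∫ y, (if 0 < y ∧ y ≤ x then f y * u (x - y) else 0) else 0 := by
    funext x
    split_ifs with hx
    · rw [intervalIntegral.integral_of_le hx, ← integral_indicator measurableSet_Ioc]
      simp only [Set.indicator_apply, Set.mem_Ioc]
    · rfl
  rw [h3]
  exact Measurable.ite measurableSet_Ici h2 measurable_const

lemma conv_densityLaw (hfm : Measurable f) (hum : Measurable u)
    (hf : ∀ᵐ x : ℝ, x ≤ 0 → f x = 0) (hf0 : ∀ x, 0 ≤ f x)
    (hu : ∀ x < 0, u x = 0) (hu0 : ∀ x, 0 ≤ u x)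
    [IsProbabilityMeasure (densityLaw f)] [IsProbabilityMeasure (densityLaw u)] :
    densityLaw f ∗ densityLaw u =
      densityLaw fun x => if 0 ≤ x then ∫ y in (0 : ℝ)..x, f y * u (x - y) else 0 := by
  rw [densityLaw, densityLaw, conv_withDensity_eq_lconvolution hfm.ennreal_ofReal
    hum.ennreal_ofReal, densityLaw]
  refine withDensity_congr_ae ?_
  filter_upwards [ae_integrableOn_convolution hfm hum hf hf0 hu hu0] with x hx
  rw [lconvolution_eq hf hf0 hu]
  split_ifs with h0
  · rw [intervalIntegral.integral_of_le h0, ofReal_integral_eq_lintegral_ofReal hx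
      (Filter.Eventually.of_forall fun y => mul_nonneg (hf0 y) (hu0 _))]
  · rw [Set.Ioc_eq_empty (fun h => h0 h.le)]
    simp

lemma integrable_of_densityLaw (hum : Measurable u) (hu0 : ∀ x, 0 ≤ u x)
    [IsProbabilityMeasure (densityLaw u)] : Integrable u := by
  refine ⟨hum.aestronglyMeasurable, ?_⟩
  rw [hasFiniteIntegral_iff_ofReal (Filter.Eventually.of_forall hu0)]
  have h2 : (densityLaw u) Set.univ = 1 := measure_univ
  rw [densityLaw, withDensity_apply _ .univ, Measure.restrict_univ] at h2
  rw [h2]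
  exact ENNReal.one_lt_top

lemma densityLaw_Iic (hum : Measurable u) (hu : ∀ x < 0, u x = 0) (hu0 : ∀ x, 0 ≤ u x)
    [IsProbabilityMeasure (densityLaw u)] {q : ℝ} (hq : 0 ≤ q) :
    densityLaw u (Set.Iic q) = ENNReal.ofReal (∫ t in (0 : ℝ)..q, u t) := by
  have hi := integrable_of_densityLaw hum hu0
  rw [densityLaw, withDensity_apply _ measurableSet_Iic, intervalIntegral.integral_of_le hq,
    ofReal_integral_eq_lintegral_ofReal hi.integrableOn (Filter.Eventually.of_forall hu0),
    ← lintegral_indicator measurableSet_Iic, ← lintegral_indicator measurableSet_Ioc]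
  refine lintegral_congr_ae ?_
  filter_upwards [measure_eq_zero_iff_ae_notMem.1 (measure_singleton (0 : ℝ))] with x hx
  rcases lt_or_ge x 0 with h | h
  · simp only [Set.indicator_apply, hu x h, ENNReal.ofReal_zero, ite_self]
  · have : 0 < x := lt_of_le_of_ne h fun h => hx h.symm
    simp [Set.indicator_apply, this]

/-- Conditioning on the first summand `y` leaves the distribution function of the second at `p - y`.
Integrability comes for free, as the lower integral is a probability. -/
lemma prod_densityLaw_add_le (hfm : Measurable f) (hum : Measurable u)
    (hf : ∀ᵐ x : ℝ, x ≤ 0 → f x = 0) (hf0 : ∀ x, 0 ≤ f x)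
    (hu : ∀ x < 0, u x = 0) (hu0 : ∀ x, 0 ≤ u x)
    [IsProbabilityMeasure (densityLaw f)] [IsProbabilityMeasure (densityLaw u)]
    {p : ℝ} (hp : 0 ≤ p) :
    IntervalIntegrable (fun y => f y * ∫ t in (0 : ℝ)..(p - y), u t) volume 0 p ∧
    (densityLaw f ∗ densityLaw u).real (Set.Iic p) =
      ∫ y in (0 : ℝ)..p, f y * ∫ t in (0 : ℝ)..(p - y), u t := by
  have hi := integrable_of_densityLaw hum hu0
  have hcont : Continuous fun y => ∫ t in (0 : ℝ)..(p - y), u t :=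
    (intervalIntegral.continuous_primitive (fun a b => hi.intervalIntegrable) 0).comp
      (by fun_prop)
  have hm : Measurable fun y => f y * ∫ t in (0 : ℝ)..(p - y), u t := hfm.mul hcont.measurable
  have hpos : ∀ᵐ y ∂volume.restrict (Set.Ioc 0 p),
      0 ≤ f y * ∫ t in (0 : ℝ)..(p - y), u t := by
    filter_upwards [ae_restrict_mem measurableSet_Ioc] with y hy
    exact mul_nonneg (hf0 y) (intervalIntegral.integral_nonneg (by linarith [hy.2])
      fun t _ => hu0 t)
  have key : (densityLaw f ∗ densityLaw u) (Set.Iic p) =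
      ∫⁻ y in Set.Ioc 0 p, ENNReal.ofReal (f y * ∫ t in (0 : ℝ)..(p - y), u t) := by
    have ma : Measurable fun q : ℝ × ℝ => q.1 + q.2 := by fun_prop
    rw [Measure.conv, Measure.map_apply ma measurableSet_Iic,
      Measure.prod_apply (ma measurableSet_Iic)]
    have h1 : ∀ y, Prod.mk y ⁻¹' ((fun q : ℝ × ℝ => q.1 + q.2) ⁻¹' Set.Iic p) =
        Set.Iic (p - y) := by
      intro y; ext t
      simp only [Set.mem_preimage, Set.mem_Iic, le_sub_iff_add_le']
    simp only [h1]
    have h2 : Measurable fun y => densityLaw u (Set.Iic (p - y)) := by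
      simp only [← h1]
      exact measurable_measure_prodMk_left (ma measurableSet_Iic)
    conv_lhs => rw [densityLaw]
    rw [lintegral_withDensity_eq_lintegral_mul _ hfm.ennreal_ofReal h2,
      ← lintegral_indicator measurableSet_Ioc]
    refine lintegral_congr_ae ?_
    filter_upwards [hf] with y hy
    rw [Pi.mul_apply]
    by_cases h0 : y ≤ 0
    · rw [hy h0, Set.indicator_of_notMem fun h => not_lt.2 h0 h.1]
      simp
    · by_cases hx : p < y
      · have : densityLaw u (Set.Iic (p - y)) = 0 := by
          rw [densityLaw, withDensity_apply _ measurableSet_Iic]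
          refine (setLIntegral_congr_fun measurableSet_Iic fun t ht => ?_).trans lintegral_zero
          rw [hu t (lt_of_le_of_lt ht (by linarith)), ENNReal.ofReal_zero]
        rw [Set.indicator_of_notMem fun h => not_lt.2 h.2 hx, this, mul_zero]
      · rw [Set.indicator_of_mem (Set.mem_Ioc.2 ⟨not_le.1 h0, not_lt.1 hx⟩), ENNReal.ofReal_mul (hf0 y),
          densityLaw_Iic hum hu hu0 (by linarith)]
  have hint : IntegrableOn (fun y => f y * ∫ t in (0 : ℝ)..(p - y), u t) (Set.Ioc 0 p) := by
    refine ⟨hm.aestronglyMeasurable, ?_⟩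
    rw [hasFiniteIntegral_iff_ofReal hpos, ← key]
    exact measure_lt_top _ _
  refine ⟨(intervalIntegrable_iff_integrableOn_Ioc_of_le hp).2 hint, ?_⟩
  rw [measureReal_def, key, intervalIntegral.integral_of_le hp,
    ← ofReal_integral_eq_lintegral_ofReal hint hpos,
    ENNReal.toReal_ofReal (integral_nonneg_of_ae hpos)]

end Convolution

/-! ### The peak age -/

section PeakAge

variable {Ω : Type*} {N : ℕ}

lemma received_toInput (X S : Fin N → ℕ → Ω → ℝ) (j : Fin N) (n : ℕ) (ω : Ω) :
    Received X S j n ω = Received interarrival service j n (toInput X S ω) := rfl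

lemma receivedIndex_toInput (X S : Fin N → ℕ → Ω → ℝ) (j : Fin N) (k : ℕ) (ω : Ω) :
    receivedIndex X S j k ω = receivedIndex interarrival service j k (toInput X S ω) := by
  simp only [receivedIndex, received_toInput X S]

lemma receivedArrival_toInput (X S : Fin N → ℕ → Ω → ℝ) (j : Fin N) (k : ℕ) :
    receivedArrival X S j k = receivedArrival interarrival service j k ∘ toInput X S := by
  funext ω
  simp only [receivedArrival, receivedIndex_toInput X S, Function.comp_apply]
  rfl

lemma departure_toInput (X S : Fin N → ℕ → Ω → ℝ) (j : Fin N) (k : ℕ) :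
    departure X S j k = departure interarrival service j k ∘ toInput X S := by
  funext ω
  simp only [departure, receivedArrival_toInput X S, receivedIndex_toInput X S,
    Function.comp_apply]
  rfl

lemma systemTime_toInput (X S : Fin N → ℕ → Ω → ℝ) (j : Fin N) (k : ℕ) :
    systemTime X S j k = systemTime interarrival service j k ∘ toInput X S := by
  funext ω
  simp only [systemTime, receivedArrival_toInput X S, departure_toInput X S, Function.comp_apply]

lemma interDeparture_toInput (X S : Fin N → ℕ → Ω → ℝ) (j : Fin N) (k : ℕ) :
    interDeparture X S j k = interDeparture interarrival service j k ∘ toInput X S := by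
  funext ω
  simp only [interDeparture, departure_toInput X S, Function.comp_apply]

variable [MeasurableSpace Ω] {P : Measure Ω} {rate : Fin N → ℝ} {fS : ℝ → ℝ}
  {X S : Fin N → ℕ → Ω → ℝ}

/-- The density of the service time of an uninterrupted update, where `lam` is the total rate. -/
noncomputable def systemDensity (fS : ℝ → ℝ) (lam : ℝ) (t : ℝ) : ℝ :=
  1 / laplace fS lam * (Real.exp (-lam * t) * fS t)

lemma exists_isPDF_of_absolutelyContinuous (η : Measure ℝ) [IsFiniteMeasure η]
    (h : η ≪ volume) : ∃ f : ℝ → ℝ, Measurable f ∧ (∀ x, 0 ≤ f x) ∧ densityLaw f = η := by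
  refine ⟨fun x => (η.rnDeriv volume x).toReal, (Measure.measurable_rnDeriv _ _).ennreal_toReal,
    fun x => ENNReal.toReal_nonneg, ?_⟩
  conv_rhs => rw [← Measure.withDensity_rnDeriv_eq η volume h]
  refine withDensity_congr_ae ?_
  filter_upwards [Measure.rnDeriv_lt_top η volume] with x hx
  exact ENNReal.ofReal_toReal hx.ne

lemma IsPDF.ae_nonneg {Y : Ω → ℝ} {f : ℝ → ℝ} (h : IsPDF P Y f) (hf : ∀ x < 0, f x = 0) :
    ∀ᵐ ω ∂P, 0 ≤ Y ω := by
  have : ∀ᵐ x ∂densityLaw f, 0 ≤ x := by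
    rw [densityLaw, ae_withDensity_iff h.measurable.ennreal_ofReal]
    refine Filter.Eventually.of_forall fun x hx => ?_
    by_contra hneg
    exact hx (by simp [hf x (not_le.1 hneg)])
  rw [densityLaw, ← h.map_eq] at this
  exact ae_of_ae_map h.aemeasurable this

lemma IsInput.ae_nonneg_densityLaw (h : IsInput P rate fS X S) (i : Fin N) :
    ∀ᵐ s ∂densityLaw fS, 0 ≤ s := by
  have hS := h.service_pdf i 0
  rw [densityLaw, ← hS.map_eq, ae_map_iff hS.aemeasurable measurableSet_Ici]
  exact hS.ae_nonneg h.service_nonneg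

variable [IsProbabilityMeasure P]

/-- The system time and the next inter-departure time of source `i` are independent, and their
joint law is the same for all received updates. -/
theorem IsInput.exists_joint_law (h : IsInput P rate fS X S) (i : Fin N) :
    (∀ᵐ ω ∂P, {n | Received X S i n ω}.Infinite) ∧
    (∀ k, Measurable (systemTime X S i k)) ∧ (∀ k, Measurable (interDeparture X S i k)) ∧
    IsProbabilityMeasure (systemLaw rate (densityLaw fS)) ∧
    ∃ η : Measure ℝ, IsProbabilityMeasure η ∧ η ≪ volume ∧ (∀ᵐ y ∂η, 0 ≤ y) ∧
      ∀ k, P.map (fun ω => (systemTime X S i k ω, interDeparture X S i k ω)) =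
        (systemLaw rate (densityLaw fS)).prod η := by
  obtain ⟨α, hα, hlaw, hmap⟩ := h.exists_updatesLaw i
  have i1 := isProbabilityMeasure_densityLaw (h.service_pdf i 0)
  have hν := h.ae_nonneg_densityLaw i
  have hm := h.measurable_toInput
  have hd : P.map (departure X S i 0) =
      (Measure.pi α).map (departure interarrival service i 0) := by
    rw [← hmap, Measure.map_map (measurable_departure i 0) hm, departure_toInput]
  have mT : ∀ k, Measurable (systemTime X S i k) := fun k => by
    rw [systemTime_toInput]; exact (measurable_systemTime i k).comp hm
  have mY : ∀ k, Measurable (interDeparture X S i k) := fun k => by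
    rw [interDeparture_toInput]; exact (measurable_interDeparture i k).comp hm
  have md : Measurable (departure X S i 0) := by
    rw [departure_toInput]; exact (measurable_departure i 0).comp hm
  refine ⟨?_, mT, mY, hlaw.isProbabilityMeasure_systemLaw i hν,
    P.map (departure X S i 0), Measure.isProbabilityMeasure_map md.aemeasurable, ?_, ?_, ?_⟩
  · have := hlaw.ae_infReceived i hν
    rw [← hmap] at this
    filter_upwards [ae_of_ae_map hm.aemeasurable this] with ω hω
    simp only [received_toInput X S]
    exact hω
  · rw [hd]
    exact absolutelyContinuous_map_departure hlaw i hν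
  · rw [ae_map_iff md.aemeasurable measurableSet_Ici]
    have h1 := hlaw.ae_posInterarrival
    rw [← hmap] at h1
    have h2 : ∀ᵐ ω ∂P, ∀ n, 0 ≤ S i n ω :=
      ae_all_iff.2 fun n => (h.service_pdf i n).ae_nonneg h.service_nonneg
    filter_upwards [ae_of_ae_map hm.aemeasurable h1, h2] with ω h1 h2
    -- Both bounds hold for every index, so it does not matter which one is selected.
    exact add_nonneg (h1.arrival_pos i (receivedIndex X S i 0 ω)).le (h2 _)
  · intro k
    rw [hd, ← map_systemTime_interDeparture hlaw i hν k, ← hmap, Measure.map_map _ hm,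
      systemTime_toInput, interDeparture_toInput]
    · rfl
    · exact (measurable_systemTime i k).prodMk (measurable_interDeparture i k)

lemma measurable_systemDensity (hf : Measurable fS) (lam : ℝ) :
    Measurable (systemDensity fS lam) := by
  unfold systemDensity; fun_prop

lemma laplace_nonneg (hf0 : ∀ x, 0 ≤ fS x) (lam : ℝ) : 0 ≤ laplace fS lam :=
  integral_nonneg fun t => mul_nonneg (Real.exp_pos _).le (hf0 t)

lemma systemDensity_nonneg (hf0 : ∀ x, 0 ≤ fS x) (lam t : ℝ) : 0 ≤ systemDensity fS lam t :=
  mul_nonneg (one_div_nonneg.2 (laplace_nonneg hf0 lam)) (mul_nonneg (Real.exp_pos _).le (hf0 t))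

lemma IsInput.systemLaw_eq (h : IsInput P rate fS X S) (i : Fin N) :
    systemLaw rate (densityLaw fS) = densityLaw (systemDensity fS (∑ l, rate l)) := by
  have hS := h.service_pdf i 0
  have i1 := isProbabilityMeasure_densityLaw hS
  obtain ⟨α, hα, hlaw, -⟩ := h.exists_updatesLaw i
  have hν := h.ae_nonneg_densityLaw i
  set lam := ∑ l, rate l with hlam
  have mf := hS.measurable
  have hpos : ∀ t, 0 ≤ Real.exp (-lam * t) * fS t := fun t =>
    mul_nonneg (Real.exp_pos _).le (hS.nonneg t)
  have e0 : ∀ t, ENNReal.ofReal (fS t) * ENNReal.ofReal (Real.exp (-(lam * t))) =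
      ENNReal.ofReal (Real.exp (-lam * t) * fS t) := fun t => by
    rw [← ENNReal.ofReal_mul (hS.nonneg t), neg_mul, mul_comm]
  have hc : uninterruptedProb rate (densityLaw fS) = ENNReal.ofReal (laplace fS lam) := by
    have hm : Measurable fun t => Real.exp (-lam * t) * fS t := by fun_prop
    have e1 : uninterruptedProb rate (densityLaw fS) =
        ∫⁻ t in Set.Ioi (0 : ℝ), ENNReal.ofReal (Real.exp (-lam * t) * fS t) := by
      rw [hlaw.uninterruptedProb_eq i hν, densityLaw,
        lintegral_withDensity_eq_lintegral_mul _ mf.ennreal_ofReal (by fun_prop),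
        ← lintegral_indicator measurableSet_Ioi]
      refine lintegral_congr_ae ?_
      filter_upwards [measure_eq_zero_iff_ae_notMem.1 (measure_singleton (0 : ℝ))] with t ht
      simp only [Pi.mul_apply, ← hlam, e0]
      rcases lt_or_ge t 0 with h0 | h0
      · simp [Set.indicator_apply, h.service_nonneg t h0]
      · rw [Set.indicator_of_mem (Set.mem_Ioi.2 (lt_of_le_of_ne h0 fun h => ht h.symm))]
    have hint : IntegrableOn (fun t => Real.exp (-lam * t) * fS t) (Set.Ioi 0) := by
      refine ⟨hm.aestronglyMeasurable, ?_⟩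
      rw [hasFiniteIntegral_iff_ofReal (Filter.Eventually.of_forall hpos), ← e1]
      exact (hlaw.uninterruptedProb_ne_top i).lt_top
    rw [e1, laplace, ofReal_integral_eq_lintegral_ofReal hint (Filter.Eventually.of_forall hpos)]
  -- Positivity allows the inverse to pass through `ENNReal.ofReal`; at `0` the two inverses differ.
  have hL : 0 < laplace fS lam := by
    have := hlaw.uninterruptedProb_ne_zero i hν
    rw [hc] at this
    simpa using this
  rw [systemLaw, hc, densityLaw, ← withDensity_mul _ mf.ennreal_ofReal (by fun_prop),
    ← withDensity_smul _ (by fun_prop), densityLaw]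
  congr 1
  funext t
  rw [Pi.smul_apply, Pi.mul_apply, ← hlam, e0, systemDensity, one_div,
    ENNReal.ofReal_mul (p := (laplace fS lam)⁻¹) (by positivity), ENNReal.ofReal_inv_of_pos hL, smul_eq_mul]

end PeakAge

end MultiSourceQueue

/-! ### The main theorem -/

open MultiSourceQueue

theorem theorem1 {Ω : Type*} [MeasurableSpace Ω] (P : Measure Ω) [IsProbabilityMeasure P]
    {N : ℕ} (rate : Fin N → ℝ) (fS : ℝ → ℝ) (X S : Fin N → ℕ → Ω → ℝ)
    (hin : MultiSourceQueue.IsInput P rate fS X S) (lam : ℝ) (hlam : lam = ∑ j, rate j)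
    (i : Fin N) :
    -- almost surely infinitely many updates of source `i` are received
    (∀ᵐ ω ∂P, {n | MultiSourceQueue.Received X S i n ω}.Infinite) ∧
    -- the inter-departure times of source `i` have a common p.d.f.
    (∃ fY : ℝ → ℝ, ∀ k, MultiSourceQueue.IsPDF P (MultiSourceQueue.interDeparture X S i k) fY) ∧
    -- the peak age is the inter-departure time plus the system time
    (∀ k ω, MultiSourceQueue.peakAge X S i k ω =
      MultiSourceQueue.interDeparture X S i k ω + MultiSourceQueue.systemTime X S i k ω) ∧
    ∀ fY : ℝ → ℝ, (∀ k, MultiSourceQueue.IsPDF P (MultiSourceQueue.interDeparture X S i k) fY) →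
      -- the violation probability, whose integral converges
      (∀ (k : ℕ) (p : ℝ), 0 < p →
        IntervalIntegrable
          (fun y => fY y * ∫ t in (0 : ℝ)..(p - y), Real.exp (-lam * t) * fS t) volume 0 p ∧
        MultiSourceQueue.violationProb X S P i k p =
          1 - 1 / MultiSourceQueue.laplace fS lam *
            ∫ y in (0 : ℝ)..p, fY y * ∫ t in (0 : ℝ)..(p - y), Real.exp (-lam * t) * fS t) ∧
      -- the p.d.f. of the peak age, whose integral converges for almost every `x`
      (∀ᵐ x : ℝ, 0 ≤ x → IntervalIntegrable
        (fun y => Real.exp (-lam * (x - y)) * fY y * fS (x - y)) volume 0 x) ∧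
      (∀ k, MultiSourceQueue.IsPDF P (MultiSourceQueue.peakAge X S i k)
        (fun x => if 0 ≤ x then
          1 / MultiSourceQueue.laplace fS lam *
            ∫ y in (0 : ℝ)..x, Real.exp (-lam * (x - y)) * fY y * fS (x - y)
          else 0)) := by
  obtain ⟨hinf, mT, mY, iτ, η, iη, hη, hη0, hjoint⟩ := hin.exists_joint_law i
  have hpeak : ∀ k ω, peakAge X S i k ω = interDeparture X S i k ω + systemTime X S i k ω := by
    intro k ω
    simp only [peakAge, interDeparture, systemTime]
    ring
  have hY : ∀ k, P.map (interDeparture X S i k) = η := by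
    intro k
    have : interDeparture X S i k =
        Prod.snd ∘ fun ω => (systemTime X S i k ω, interDeparture X S i k ω) := rfl
    rw [this, ← Measure.map_map measurable_snd ((mT k).prodMk (mY k)), hjoint k,
      Measure.map_snd_prod, measure_univ, one_smul]
  refine ⟨hinf, ?_, hpeak, ?_⟩
  · obtain ⟨f, hf, hf0, hfη⟩ := exists_isPDF_of_absolutelyContinuous η hη
    exact ⟨f, fun k => ⟨hf, hf0, (mY k).aemeasurable, (hY k).trans hfη.symm⟩⟩
  intro fY hfY
  -- From here on the version `fY` enters only through its law and its pointwise nonnegativity and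
  -- measurability.
  have hfη : η = densityLaw fY := (hY 0).symm.trans (hfY 0).map_eq
  have hS := hin.service_pdf i 0
  have mf := (hfY 0).measurable
  have hf0 := (hfY 0).nonneg
  have mu := measurable_systemDensity hS.measurable lam
  have hu0 := systemDensity_nonneg hS.nonneg lam
  have hu : ∀ t < 0, systemDensity fS lam t = 0 := fun t ht => by
    simp [systemDensity, hin.service_nonneg t ht]
  have hτ := hin.systemLaw_eq i
  rw [← hlam] at hτ
  rw [hτ] at iτ hjoint
  rw [hfη] at iη hη0 hjoint
  have hf := ae_eq_zero_of_densityLaw mf hf0 hη0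
  have mP : ∀ k, Measurable (peakAge X S i k) := fun k => by
    rw [funext (hpeak k)]
    exact (mY k).add (mT k)
  have hlaw : ∀ k, P.map (peakAge X S i k) =
      densityLaw fY ∗ densityLaw (systemDensity fS lam) := by
    intro k
    have : peakAge X S i k =
        (fun q : ℝ × ℝ => q.1 + q.2) ∘ fun ω => (systemTime X S i k ω, interDeparture X S i k ω) := by
      funext ω
      rw [hpeak, add_comm]
      rfl
    rw [this, ← Measure.map_map (by fun_prop) ((mT k).prodMk (mY k)), hjoint k,
      Measure.conv_comm]
    rfl
  -- If the transform were `0`, then `1 / 0 = 0` would make `systemDensity` vanish, contradicting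
  -- its total mass one.
  have hLpos : 0 < laplace fS lam := by
    refine lt_of_le_of_ne (laplace_nonneg hS.nonneg lam) fun h0 => ?_
    have h1 : densityLaw (systemDensity fS lam) Set.univ = 1 := measure_univ
    simp [densityLaw, systemDensity, ← h0] at h1
  have e1 : ∀ x y, fY y * systemDensity fS lam (x - y) = 1 / laplace fS lam *
      (Real.exp (-lam * (x - y)) * fY y * fS (x - y)) := fun x y => by
    rw [systemDensity]; ring
  have e2 : ∀ p y, fY y * ∫ t in (0 : ℝ)..(p - y), systemDensity fS lam t =
      1 / laplace fS lam * (fY y * ∫ t in (0 : ℝ)..(p - y), Real.exp (-lam * t) * fS t) :=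
    fun p y => by
      simp only [systemDensity, intervalIntegral.integral_const_mul]; ring
  refine ⟨fun k p hp => ?_, ?_, fun k => ?_⟩
  · obtain ⟨h1, h2⟩ := prod_densityLaw_add_le mf mu hf hf0 hu hu0 hp.le
    simp only [e2] at h1 h2
    constructor
    · have := h1.const_mul (laplace fS lam)
      simpa only [← mul_assoc, mul_one_div_cancel hLpos.ne', one_mul] using this
    · rw [intervalIntegral.integral_const_mul, ← hlaw k,
        map_measureReal_apply (mP k) measurableSet_Iic] at h2
      rw [← h2, violationProb, ← probReal_compl_eq_one_sub ((mP k) measurableSet_Iic)]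
      congr 1
      ext ω
      simp
  · filter_upwards [ae_integrableOn_convolution mf mu hf hf0 hu hu0] with x hx h0
    simp only [e1] at hx
    have := ((intervalIntegrable_iff_integrableOn_Ioc_of_le h0).2 hx).const_mul (laplace fS lam)
    simpa only [← mul_assoc, mul_one_div_cancel hLpos.ne', one_mul] using this
  · have e3 : (fun x : ℝ => if 0 ≤ x then 1 / laplace fS lam *
        ∫ y in (0 : ℝ)..x, Real.exp (-lam * (x - y)) * fY y * fS (x - y) else 0) =
        fun x => if 0 ≤ x then ∫ y in (0 : ℝ)..x, fY y * systemDensity fS lam (x - y) else 0 := by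
      funext x
      simp only [e1, intervalIntegral.integral_const_mul]
    rw [e3]
    refine ⟨measurable_convolution mf mu, fun x => ?_, (mP k).aemeasurable, ?_⟩
    · split_ifs with h0
      · exact intervalIntegral.integral_nonneg h0 fun y _ => mul_nonneg (hf0 y) (hu0 _)
      · exact le_rfl
    · exact (hlaw k).trans (conv_densityLaw mf mu hf hf0 hu hu0)
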